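/- **Setting.** Fix integers $p,r\ge 0$. For each $T$ let $N=N_T$, with $N_T\to\infty$ as $T\to\infty$ (for instance $N\gg T$), and consider the panel $$Y_{it}=\mu_i+\boldsymbol\beta_i^\top\mathbf X_t+\varepsilon_{it},\qquad \mathcal E_t=(\varepsilon_{1t},\dots,\varepsilon_{Nt})^\top=\boldsymbol\gamma\,\mathbf Z_t+\boldsymbol\eta_{\cdot t},\qquad 1\le i\le N,\ 1\le t\le T,$$ with non-random $\mu_i\in\mathbb R$, $\boldsymbol\beta_i\in\mathbb R^p$, $\boldsymbol\gamma=(\boldsymbol\gamma_1,\dots,\boldsymbol\gamma_N)^\top\in\mathbb R^{N\times r}$ (all may depend on $T$), observed factors $\mathbf X_t\in\mathbb R^p$ and latent factors $\mathbf Z_t\in\mathbb R^r$. The processes $(\mathbf X_t)$, $(\mathbf Z_t)$, $(\boldsymbol\eta_{\cdot t})$ are independent of each other, $(\mathbf Z_t)$ and $(\boldsymbol\eta_{\cdot t})$ are independent over $t$, $\mathcal E_t$ is normal with mean $\mathbf 0$, $\operatorname{cov}(\mathbf Z_t)=\mathbf I_r$, $\boldsymbol\eta_{\cdot t}\sim\mathbb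 N(\mathbf 0,\Sigma_{\boldsymbol\eta})$ with $\Sigma_{\boldsymbol\eta}=(\sigma_{ij})$, $E(X_{jt})=0$ and $\operatorname{var}(Y_{it})=1$. Write $\mathbb X$ for the $T\times p$ matrix with rows $\mathbf X_t^\top$, $\mathbb Y=(Y_{it})$ and $\mathcal E=(\varepsilon_{it})$ ($N\times T$), $\mathbb Y_i=(Y_{i1},\dots,Y_{iT})^\top$, $\mathcal Q(\mathbf A)=\mathbf I-\mathbf A(\mathbf A^\top\mathbf A)^{-1}\mathbf A^\top$, $\mathcal Q=\mathcal Q(\mathbb X)$, $\mathbf 1=(1,\dots,1)^\top\in\mathbb R^T$, and $\Sigma_{\mathcal E}=\boldsymbol\gamma\boldsymbol\gamma^\top+\Sigma_{\boldsymbol\eta}$. The design is nondegenerate: for some $c>0$, with probability tending to one $\mathbb X^\top\mathbb X$ is invertible and $\mathbf 1^\top\mathcal Q\mathbf 1\ge cT$. Let $\mathcal N_1=\{i:\mu_i\ne0\}$, $N_1=|\mathcal N_1|$, $N_0=N-N_1$. **Procedure.** Let $\widehat\mu_i=(\mathbf 1^\top\mathcal Q\mathbf 1)^{-1}\mathbf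 1^\top\mathcal Q\mathbb Y_i$ and $\widehat{\mathcal E}^\top=\mathcal Q\mathbb Y^\top$. Let $\widehat{\mathbf Z}=T^{1/2}(\widehat{\boldsymbol\varrho}_1,\dots,\widehat{\boldsymbol\varrho}_r)$, where $\widehat{\boldsymbol\varrho}_1,\dots,\widehat{\boldsymbol\varrho}_r$ are any orthonormal eigenvectors for the $r$ largest eigenvalues of $(TN)^{-1}\widehat{\mathcal E}^\top\widehat{\mathcal E}$ (the number $r$ of latent factors is known), $\widehat{\boldsymbol\gamma}^\top=(\widehat{\mathbf Z}^\top\widehat{\mathbf Z})^{-1}\widehat{\mathbf Z}^\top\widehat{\mathcal E}^\top$, $\widehat{\boldsymbol\eta}^\top=\mathcal Q(\widehat{\mathbf Z})\widehat{\mathcal E}^\top$, $\widehat\sigma_{ii}=T^{-1}\sum_t\widehat\eta_{it}^2$, $$\widehat T_i=\frac{(\mathbf 1^\top\mathcal Q\mathbf 1)^{1/2}\widehat\mu_i-(\mathbf 1^\top\mathcal Q\mathbf 1)^{-1/2}\mathbf 1^\top\mathcal Q\widehat{\mathbf Z}\widehat{\boldsymbol\gamma}_i}{\widehat\sigma_{ii}^{1/2}},\qquad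 P_i=2\Phi(-|\widehat T_i|),\qquad \widehat{\mathcal N}_1^{\,s}=\{i:P_i\le s\},$$ where $\Phi$ is the standard normal distribution function. **Assumptions.** - (2.3) For some $\delta>0$, $N^{-2+\delta}\sum_{i\ne j}|\sigma_{ij}|/(\sigma_{ii}\sigma_{jj})^{1/2}=O(1)$. - (C1) $\log N\le C_\hbar T^{\hbar}$ for constants $0<\hbar<1/2$ and $C_\hbar>0$. - (C2) For a finite constant $C_{\boldsymbol\mu}$, $\|\boldsymbol\mu\|\le C_{\boldsymbol\mu}\min\{N^{1/2}/T^{1/2},\,N/(TN_1^{1/2})\}$. - (C3) $\min_i\sigma_{ii}\ge\sigma_0^2$ for a constant $\sigma_0>0$. - (C4) $N^{-1}\boldsymbol\gamma^\top\boldsymbol\gamma\to\Sigma_{\boldsymbol\gamma}$ for a positive definite $r\times r$ matrix $\Sigma_{\boldsymbol\gamma}$, and $\max_i\|\boldsymbol\gamma_i\|^2\le\gamma_{\max}$ for a constant $\gamma_{\max}$. - (C5) For some $\nu>0$, $\max_{i\le r}\|\overline{\boldsymbol\psi}_i-\boldsymbol\psi_i\|=O_p(N^{-\nu})$, where $\overline{\boldsymbol\psi}_i$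 and $\boldsymbol\psi_i$ are suitably chosen orthonormal eigenvectors for the $i$-th largest eigenvalues of $T^{-1}\mathcal E\mathcal E^\top$ and $\Sigma_{\mathcal E}$. (The inequalities in (C1)–(C4) are only required for all large $T$.) **Theorem.** Assume all of the above, $\pi_0=\lim N_0/N=1$, and $\min_{i\in\mathcal N_1}|\mu_i|\ge c_1T^{-\kappa}$ for all large $T$, with constants $c_1>0$ and $\kappa\in\mathbb R$ such that $\kappa+\hbar/2<1/2$. Then there is a sequence of thresholds $t_T\to0$ such that $$\mathrm P\big(\widehat{\mathcal N}_1^{\,t_T}=\mathcal N_1\big)\to1\qquad(T\to\infty).$$ Explicitly, for every $c_2>0$ and every $\jmath$ with $\hbar/2<\jmath<\min\{1/2-\kappa,\,1/2\}$, the thresholds $t_T=2\{1-\Phi(c_2T^{\jmath})\}$ (for instance with $c_2=2$) tend to $0$ and have this property. -/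

import Mathlib

open Filter Topology MeasureTheory ProbabilityTheory
open scoped BigOperators Matrix

noncomputable section

namespace FAT

/-! ### The estimators and the factor-adjusted p-values, for one data set -/

/-- The annihilator matrix `I - A (Aᵀ A)⁻¹ Aᵀ` of a design matrix `A` with `n` rows. -/
def annihilator {n k : ℕ} (A : Matrix (Fin n) (Fin k) ℝ) : Matrix (Fin n) (Fin n) ℝ :=
  1 - A * (Aᵀ * A)⁻¹ * Aᵀ

/-- `v` lists unit eigenvectors of the symmetric matrix `A` belonging to its `r` largest
eigenvalues (with multiplicity): `v` is the initial part of an orthonormal basis of eigenvectors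
whose eigenvalues are in decreasing order. -/
def IsLeadingEigenvectors {n r : ℕ} (A : Matrix (Fin n) (Fin n) ℝ)
    (v : Fin r → EuclideanSpace ℝ (Fin n)) : Prop :=
  ∃ (h : r ≤ n) (b : OrthonormalBasis (Fin n) ℝ (EuclideanSpace ℝ (Fin n))) (l : Fin n → ℝ),
    Antitone l ∧ (∀ i, A *ᵥ (b i).ofLp = l i • (b i).ofLp) ∧ ∀ j, v j = b (Fin.castLE h j)

section Estimators

variable {n T p r : ℕ} (X : Matrix (Fin T) (Fin p) ℝ) (Y : Matrix (Fin n) (Fin T) ℝ)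
  (v : Fin r → EuclideanSpace ℝ (Fin T))

/-- The scalar `1ᵀ Q 1`, with `Q` the annihilator of the observed regressors. -/
def oneQone : ℝ := (1 : Fin T → ℝ) ⬝ᵥ (annihilator X *ᵥ (1 : Fin T → ℝ))

/-- The least squares intercept of unit `i`: `(1ᵀ Q 1)⁻¹ 1ᵀ Q Y_i`. -/
def muHat (i : Fin n) : ℝ := (oneQone X)⁻¹ * ((1 : Fin T → ℝ) ⬝ᵥ (annihilator X *ᵥ Y i))

/-- The residual matrix, whose transpose is `Q Yᵀ`. -/
def residual : Matrix (Fin n) (Fin T) ℝ := (annihilator X * Yᵀ)ᵀ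

/-- The `T × T` matrix `(T n)⁻¹ Êᵀ Ê` whose leading eigenvectors are the principal components,
`Ê` being the residual matrix. -/
def pcaMatrix : Matrix (Fin T) (Fin T) ℝ :=
  ((T : ℝ) * (n : ℝ))⁻¹ • ((residual X Y)ᵀ * residual X Y)

/-- The estimated factors `Ẑ = T^{1/2} (v_1, …, v_r)`. -/
def factorHat : Matrix (Fin T) (Fin r) ℝ := Matrix.of fun t j => √(T : ℝ) * v j t

/-- The estimated loadings, whose transpose is `(Ẑᵀ Ẑ)⁻¹ Ẑᵀ Êᵀ`. -/
def loadingHat : Matrix (Fin n) (Fin r) ℝ :=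
  (((factorHat v)ᵀ * factorHat v)⁻¹ * (factorHat v)ᵀ * (residual X Y)ᵀ)ᵀ

/-- The estimated idiosyncratic errors, whose transpose is `Q(Ẑ) Êᵀ`. -/
def noiseHat : Matrix (Fin n) (Fin T) ℝ := (annihilator (factorHat v) * (residual X Y)ᵀ)ᵀ

/-- The estimated idiosyncratic variance of unit `i`: `T⁻¹ η̂_iᵀ η̂_i`. -/
def sigmaHat (i : Fin n) : ℝ := (T : ℝ)⁻¹ * (noiseHat X Y v i ⬝ᵥ noiseHat X Y v i)

/-- The factor-adjusted test statistic of unit `i`. -/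
def testStat (i : Fin n) : ℝ :=
  (√(oneQone X) * muHat X Y i -
      (√(oneQone X))⁻¹ *
        ((1 : Fin T → ℝ) ⬝ᵥ (annihilator X *ᵥ (factorHat v *ᵥ loadingHat X Y v i)))) /
    √(sigmaHat X Y v i)

/-- The standard normal distribution function. -/
def Phi (x : ℝ) : ℝ := cdf (gaussianReal 0 1) x

/-- The factor-adjusted p-value of unit `i`. -/
def pValue (i : Fin n) : ℝ := 2 * Phi (-|testStat X Y v i|)

/-- The set of units whose p-value does not exceed the threshold `s`. -/
def selected (s : ℝ) : Set (Fin n) := {i | pValue X Y v i ≤ s}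

end Estimators

/-! ### The model, for a sequence of panels indexed by the number `T` of observations -/

/-- A sequence of panels with `p` observed and `r` latent factors. The `T`-th panel lives on the
probability space `(Ω T, P T)` and has `T` observations of `N T` units. This is only the data; the
model assumptions are stated below. -/
structure Panel (p r : ℕ) (Ω : ℕ → Type*) [∀ T, MeasurableSpace (Ω T)] where
  /-- the number of units -/
  N : ℕ → ℕ
  /-- the probability measures -/
  P : ∀ T, Measure (Ω T)
  /-- the observed factors at time `t` -/
  X : ∀ T, Fin T → Ω T → (Fin p → ℝ)
  /-- the latent factors at time `t` -/
  Z : ∀ T, Fin T → Ω T → (Fin r → ℝ)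
  /-- the idiosyncratic errors at time `t` -/
  noise : ∀ T, Fin T → Ω T → (Fin (N T) → ℝ)
  /-- the intercepts -/
  mu : ∀ T, Fin (N T) → ℝ
  /-- the regression coefficients -/
  beta : ∀ T, Matrix (Fin (N T)) (Fin p) ℝ
  /-- the factor loadings -/
  gamma : ∀ T, Matrix (Fin (N T)) (Fin r) ℝ
  /-- the covariance matrix of the idiosyncratic errors -/
  Sigma : ∀ T, Matrix (Fin (N T)) (Fin (N T)) ℝ

/-- The events `A T` occur with `P T`-probability tending to one: their complements have
probability tending to zero (for events that are not measurable this refers to the outer measure of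
the complements). -/
def WithProbTendingToOne {Ω : ℕ → Type*} [∀ T, MeasurableSpace (Ω T)]
    (P : ∀ T, Measure (Ω T)) (A : ∀ T, Set (Ω T)) : Prop :=
  Tendsto (fun T => P T (A T)ᶜ) atTop (𝓝 0)

/-- `W T = O_p(a T)`: stochastic boundedness of `W T / a T`. -/
def IsBigOInProb {Ω : ℕ → Type*} [∀ T, MeasurableSpace (Ω T)]
    (P : ∀ T, Measure (Ω T)) (W : ∀ T, Ω T → ℝ) (a : ℕ → ℝ) : Prop :=
  ∀ ε : ENNReal, 0 < ε → ∃ M : ℝ, ∀ᶠ T in atTop, P T {ω | M * a T < |W T ω|} ≤ ε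

namespace Panel

variable {p r : ℕ} {Ω : ℕ → Type*} [∀ T, MeasurableSpace (Ω T)] (D : Panel p r Ω)

/-- The error vector at time `t`: loadings times latent factors plus idiosyncratic error. -/
def err (T : ℕ) (t : Fin T) (ω : Ω T) : Fin (D.N T) → ℝ :=
  D.gamma T *ᵥ D.Z T t ω + D.noise T t ω

/-- The response of unit `i` at time `t`. -/
def response (T : ℕ) (i : Fin (D.N T)) (t : Fin T) (ω : Ω T) : ℝ :=
  D.mu T i + D.beta T i ⬝ᵥ D.X T t ω + D.err T t ω i

/-- The `N × T` matrix of responses. -/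
def responseMatrix (T : ℕ) (ω : Ω T) : Matrix (Fin (D.N T)) (Fin T) ℝ :=
  Matrix.of fun i t => D.response T i t ω

/-- The `T × p` design matrix. -/
def designMatrix (T : ℕ) (ω : Ω T) : Matrix (Fin T) (Fin p) ℝ := Matrix.of fun t => D.X T t ω

/-- The `N × T` matrix of the errors. -/
def errMatrix (T : ℕ) (ω : Ω T) : Matrix (Fin (D.N T)) (Fin T) ℝ :=
  Matrix.of fun i t => D.err T t ω i

/-- The covariance matrix of the error vector (the latent factors have identity covariance and are
independent of the idiosyncratic errors). -/
def errCov (T : ℕ) : Matrix (Fin (D.N T)) (Fin (D.N T)) ℝ :=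
  D.gamma T * (D.gamma T)ᵀ + D.Sigma T

/-- The set of true non-nulls. -/
def nonNull (T : ℕ) : Set (Fin (D.N T)) := {i | D.mu T i ≠ 0}

/-- The Euclidean norm of the vector of intercepts. -/
def muNorm (T : ℕ) : ℝ := √(∑ i, D.mu T i ^ 2)

/-- The correlation coefficient of the idiosyncratic errors of two units. -/
def corr (T : ℕ) (i j : Fin (D.N T)) : ℝ :=
  D.Sigma T i j / √(D.Sigma T i i * D.Sigma T j j)

/-- The sampling model. -/
structure IsGaussianFactorModel : Prop where
  prob : ∀ T, IsProbabilityMeasure (D.P T)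
  meas_X : ∀ T t, Measurable (D.X T t)
  meas_Z : ∀ T t, Measurable (D.Z T t)
  meas_noise : ∀ T t, Measurable (D.noise T t)
  /-- the observed factors are independent of the latent factors and of the idiosyncratic errors -/
  indep_X : ∀ T, IndepFun (fun ω t => D.X T t ω) (fun ω t => (D.Z T t ω, D.noise T t ω)) (D.P T)
  /-- the latent factors are independent of the idiosyncratic errors -/
  indep_Z_noise : ∀ T, IndepFun (fun ω t => D.Z T t ω) (fun ω t => D.noise T t ω) (D.P T)
  /-- latent factors and idiosyncratic errors are independent over time -/
  indep_Z : ∀ T, iIndepFun (D.Z T) (D.P T)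
  indep_noise : ∀ T, iIndepFun (D.noise T) (D.P T)
  /-- the error vectors are normal with mean zero -/
  gaussian_err : ∀ T t, HasGaussianLaw (D.err T t) (D.P T)
  mean_err : ∀ T t i, ∫ ω, D.err T t ω i ∂(D.P T) = 0
  /-- the idiosyncratic error vectors are normal with mean zero and covariance matrix `Sigma` -/
  gaussian_noise : ∀ T t, HasGaussianLaw (D.noise T t) (D.P T)
  mean_noise : ∀ T t i, ∫ ω, D.noise T t ω i ∂(D.P T) = 0
  cov_noise : ∀ T t i j,
    cov[fun ω => D.noise T t ω i, fun ω => D.noise T t ω j; D.P T] = D.Sigma T i j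
  /-- the latent factors have the identity as covariance matrix -/
  memLp_Z : ∀ T t j, MemLp (fun ω => D.Z T t ω j) 2 (D.P T)
  cov_Z : ∀ T t j k,
    cov[fun ω => D.Z T t ω j, fun ω => D.Z T t ω k; D.P T] = if j = k then 1 else 0
  /-- the observed factors are centred and the responses have unit variance -/
  integrable_X : ∀ T t j, Integrable (fun ω => D.X T t ω j) (D.P T)
  mean_X : ∀ T t j, ∫ ω, D.X T t ω j ∂(D.P T) = 0
  memLp_Y : ∀ T i t, MemLp (D.response T i t) 2 (D.P T)
  var_Y : ∀ T i t, Var[D.response T i t; D.P T] = 1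

/-- The design is nondegenerate: with probability tending to one, `Xᵀ X` is invertible (so that the
least squares estimator exists) and `1ᵀ Q 1` is at least of the order `T`. -/
def NondegenerateDesign : Prop :=
  ∃ c : ℝ, 0 < c ∧ WithProbTendingToOne D.P fun T =>
    {ω | IsUnit ((D.designMatrix T ω)ᵀ * D.designMatrix T ω).det ∧
      c * (T : ℝ) ≤ oneQone (D.designMatrix T ω)}

/-- Weak dependence of the idiosyncratic errors. -/
def WeakDependence : Prop :=
  ∃ δ : ℝ, 0 < δ ∧
    (fun T => (D.N T : ℝ) ^ (-2 + δ) * ∑ i, ∑ j, if i ≠ j then |D.corr T i j| else 0)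
      =O[atTop] fun _ => (1 : ℝ)

/-- `log N ≤ C T^h`. -/
def C1 (h : ℝ) : Prop :=
  0 < h ∧ h < 1 / 2 ∧
    ∃ C : ℝ, 0 < C ∧ ∀ᶠ T : ℕ in atTop, Real.log (D.N T) ≤ C * (T : ℝ) ^ h

/-- The intercepts are sparse and weak. If there are no non-nulls, then `mu = 0` and the
inequality holds trivially. -/
def C2 : Prop :=
  ∃ C : ℝ, 0 < C ∧ ∀ᶠ T : ℕ in atTop,
    D.muNorm T ≤ C * min (√(D.N T : ℝ) / √(T : ℝ))
      ((D.N T : ℝ) / ((T : ℝ) * √((D.nonNull T).ncard : ℝ)))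

/-- The idiosyncratic variances are bounded from below. -/
def C3 : Prop := ∃ σ₀ : ℝ, 0 < σ₀ ∧ ∀ᶠ T in atTop, ∀ i, σ₀ ^ 2 ≤ D.Sigma T i i

/-- The latent factors are pervasive and the loadings bounded. -/
def C4 : Prop :=
  (∃ S : Matrix (Fin r) (Fin r) ℝ, S.PosDef ∧
    Tendsto (fun T => (D.N T : ℝ)⁻¹ • ((D.gamma T)ᵀ * D.gamma T)) atTop (𝓝 S)) ∧
  ∃ gmax : ℝ, 0 < gmax ∧ ∀ᶠ T in atTop, ∀ i, ∑ j, D.gamma T i j ^ 2 ≤ gmax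

/-- The `r` leading eigenvectors of the sample covariance matrix `T⁻¹ E Eᵀ` of the errors converge
to those of their covariance matrix, at the rate `N^{-ν}`, for some choice of the eigenvectors. -/
def C5 : Prop :=
  ∃ ν : ℝ, 0 < ν ∧
    ∃ (ψ : ∀ T, Fin r → EuclideanSpace ℝ (Fin (D.N T)))
      (ψbar : ∀ T, Ω T → Fin r → EuclideanSpace ℝ (Fin (D.N T))),
      (∀ T, r ≤ D.N T → IsLeadingEigenvectors (D.errCov T) (ψ T)) ∧
      (∀ T, r ≤ D.N T → ∀ ω,
        IsLeadingEigenvectors ((T : ℝ)⁻¹ • (D.errMatrix T ω * (D.errMatrix T ω)ᵀ)) (ψbar T ω)) ∧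
      IsBigOInProb D.P (fun T ω => ⨆ i, ‖ψbar T ω i - ψ T i‖) fun T => (D.N T : ℝ) ^ (-ν)

/-- The asymptotic proportion `lim N₀ / N` of true nulls is one. -/
def AsymptoticallyAllNull : Prop :=
  Tendsto (fun T => ((D.nonNull T)ᶜ.ncard : ℝ) / (D.N T : ℝ)) atTop (𝓝 1)

/-- The event that the selected set at threshold `s` is the set of true non-nulls, when the leading
eigenvectors used for the estimated factors are `v`. -/
def exactSelection (T : ℕ) (v : Ω T → Fin r → EuclideanSpace ℝ (Fin T)) (s : ℝ) : Set (Ω T) :=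
  {ω | selected (D.designMatrix T ω) (D.responseMatrix T ω) (v ω) s = D.nonNull T}

end Panel

end FAT

end

/-! The statistic sees the estimated factors only through the span of `v`. With `b = Q 1`, residuals
`R_i = μ_i b + Q (∑ γ_ik z_k + η_i)` and `M` the projection off that span, `testStat_eq` gives `T̂_i
= √T / √(1ᵀQ1) · ⟪b, M R_i⟫ / ‖M R_i‖`. By monotonicity of `Phi`, thresholding p-values at `2 (1 -
Φ(x))` is thresholding `|T̂_i|` at `x = c₂ T^j`. The claim is thus that, simultaneously in `i`, null
statistics stay below `x` and non-null ones reach it.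

Two facts about `v` carry the proof. First, its eigenvalues for the normalized Gram operator are at
least `s / 48`: by Courant-Fischer it suffices to bound `∑ ⟪R_i, w⟫²` below on the `r`-dimensional
space of projected latent paths (`RegularSample.le_sum_inner_sq`), where pervasive loadings dominate
intercepts and noise. Second, the eigenvector equation with Cauchy-Schwarz then gives `⟪v_j, x⟫² ≲
(nT)⁻¹ ∑ ⟪R_i, x⟫²` for every `x` (`RegularSample.inner_direction_sq_le`). With `x = b` this yields
`⟪v_j, b⟫ = O(τ)`, the smallness of `‖μ‖` keeping the intercepts harmless. With `x = Q η_i` it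
yields `⟪v_j, Q η_i⟫² = O(ε² T)`, the weak dependence bounding the row sums `∑_k σ_ki²`.

Consequently `⟪b, M R_i⟫` equals `μ_i` times a factor of order `T`, up to `O(τ √T)`, while `‖M R_i‖`
is at most `(|μ_i| + O(1)) √T` and, for nulls, at least a constant times `√T`. Null statistics are
`O(τ)`; non-null ones are at least of order `√T min(1, |μ_i|)`.

All this is deterministic on a `RegularSample`. Gaussian tails and a union bound make samples
regular with probability tending to one, for a fixed small `ε` and `τ = T^{j'}` with `h/2 < j' < j`:
`2 j' > h` beats the number of units, at most `exp(C T^h)`, and `j' < j` puts the threshold above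
the null fluctuations. The conditions `j < 1/2` and `j < 1/2 - κ` keep it below the signals. -/

noncomputable section

namespace FAT

open scoped RealInnerProductSpace

/-! ### Deterministic analysis of regular samples in an inner product space. -/

section Core

variable {H : Type*} [NormedAddCommGroup H] [InnerProductSpace ℝ H]

lemma norm_sum_smul_sq_le {ι : Type*} [Fintype ι] (a : ι → ℝ) (y : ι → H) :
    ‖∑ k, a k • y k‖ ^ 2 ≤ (∑ k, a k ^ 2) * ∑ k, ‖y k‖ ^ 2 := by
  have h1 : ‖∑ k, a k • y k‖ ≤ ∑ k, |a k| * ‖y k‖ :=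
    (norm_sum_le _ _).trans_eq (Finset.sum_congr rfl fun k _ => by rw [norm_smul, Real.norm_eq_abs])
  calc ‖∑ k, a k • y k‖ ^ 2 ≤ (∑ k, |a k| * ‖y k‖) ^ 2 := by gcongr
    _ ≤ (∑ k, |a k| ^ 2) * ∑ k, ‖y k‖ ^ 2 := Finset.sum_mul_sq_le_sq_mul_sq _ _ _
    _ = _ := by simp_rw [sq_abs]

lemma sq_sum_abs_le {r : ℕ} (a : Fin r → ℝ) : (∑ k, |a k|) ^ 2 ≤ r * ∑ k, a k ^ 2 := by
  have := Finset.sum_mul_sq_le_sq_mul_sq Finset.univ (fun _ : Fin r => (1 : ℝ)) fun k => |a k|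
  simpa using this

/-- The regression residuals of the units, with `b` the residual of the constant regressor. -/
def unitResidual {n r : ℕ} (Q : H →ₗ[ℝ] H) (b : H) (μ : Fin n → ℝ) (γ : Fin n → Fin r → ℝ)
    (z : Fin r → H) (η : Fin n → H) (i : Fin n) : H :=
  μ i • b + Q (∑ k, γ i k • z k + η i)

/-- The properties of a sample that hold with high probability. Here `τ` bounds the fluctuations of
the standardized linear statistics and `ε` the relative fluctuations of the quadratic ones. -/
structure RegularSample {n r : ℕ} (Q : H →ₗ[ℝ] H) (b : H) (μ : Fin n → ℝ) (γ : Fin n → Fin r → ℝ)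
    (z : Fin r → H) (η : Fin n → H) (σ : Fin n → Fin n → ℝ) (T τ ε g s C : ℝ) : Prop where
  one_le_T : 1 ≤ T
  one_le_τ : 1 ≤ τ
  τ_sq_le : τ ^ 2 ≤ ε ^ 2 * T
  ε_pos : 0 < ε
  ε_le : ε ≤ 1
  symm : ∀ x y, ⟪Q x, y⟫ = ⟪x, Q y⟫
  idem : ∀ x, Q (Q x) = Q x
  Q_b : Q b = b
  norm_b : ‖b‖ ^ 2 ≤ T
  z_z : ∀ k l, |⟪z k, z l⟫ - if k = l then T else 0| ≤ ε * T
  z_sub : ∀ k, ‖z k - Q (z k)‖ ^ 2 ≤ ε * T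
  η_η : ∀ k i, |⟪η k, η i⟫ - T * σ k i| ≤ ε * T
  η_sub : ∀ i, ‖η i - Q (η i)‖ ^ 2 ≤ ε * T
  b_η : ∀ i, ⟪b, η i⟫ ^ 2 ≤ τ ^ 2 * T
  b_z : ∀ k, ⟪b, z k⟫ ^ 2 ≤ τ ^ 2 * T
  z_η : ∀ k i, ⟪Q (z k), η i⟫ ^ 2 ≤ 2 * τ ^ 2 * T
  σ_diag : ∀ i, σ i i ≤ 1
  σ_row : ∀ i, ∑ k, σ k i ^ 2 ≤ ε ^ 2 * n
  g_pos : 0 < g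
  γ_le : ∀ i, ∑ k, γ i k ^ 2 ≤ g
  s_pos : 0 < s
  le_γ : ∀ a : Fin r → ℝ, n * s * ∑ k, a k ^ 2 ≤ ∑ i, (∑ k, γ i k * a k) ^ 2
  sum_μ : ∑ i, μ i ^ 2 ≤ C ^ 2 * n / T
  r_ε : r * ε ≤ 1 / 4
  small : (C ^ 2 + 8) * r * ε ^ 2 ≤ s / 24

namespace RegularSample

variable {n r : ℕ} {Q : H →ₗ[ℝ] H} {b : H} {μ : Fin n → ℝ} {γ : Fin n → Fin r → ℝ}
  {z : Fin r → H} {η : Fin n → H} {σ : Fin n → Fin n → ℝ} {T τ ε g s C : ℝ}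

section
variable (h : RegularSample Q b μ γ z η σ T τ ε g s C)
include h

lemma T_pos : 0 < T := one_pos.trans_le h.one_le_T

lemma norm_sq_eq (x : H) : ‖Q x‖ ^ 2 = ‖x‖ ^ 2 - ‖x - Q x‖ ^ 2 := by
  have h1 : ⟪x, Q x⟫ = ⟪Q x, Q x⟫ := by rw [h.symm, h.idem]
  have h2 : ‖x - Q x‖ ^ 2 = ‖x‖ ^ 2 - 2 * ⟪x, Q x⟫ + ‖Q x‖ ^ 2 := norm_sub_sq_real _ _
  rw [h2, h1, real_inner_self_eq_norm_sq]; ring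

lemma norm_le (x : H) : ‖Q x‖ ≤ ‖x‖ := by
  have := h.norm_sq_eq x
  exact abs_le_of_sq_le_sq' (by nlinarith [sq_nonneg ‖x - Q x‖]) (norm_nonneg _) |>.2

/-- The Gram matrix of the latent paths is within `ε T` of `T` times the identity in each entry,
hence within `r ε T ≤ T / 4` as a quadratic form. -/
lemma abs_norm_comb_sub_le (a : Fin r → ℝ) :
    |‖∑ k, a k • z k‖ ^ 2 - T * ∑ k, a k ^ 2| ≤ T / 4 * ∑ k, a k ^ 2 := by
  have e : ‖∑ k, a k • z k‖ ^ 2 - T * ∑ k, a k ^ 2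
      = ∑ k, ∑ l, a k * a l * (⟪z k, z l⟫ - if k = l then T else 0) := by
    rw [← real_inner_self_eq_norm_sq, sum_inner]
    simp_rw [inner_sum, real_inner_smul_left, real_inner_smul_right, mul_sub,
      Finset.sum_sub_distrib]
    congr 1
    · exact Finset.sum_congr rfl fun k _ => Finset.sum_congr rfl fun l _ => by ring
    · simp only [mul_ite, mul_zero, Finset.sum_ite_eq, Finset.mem_univ, if_true, Finset.mul_sum]
      exact Finset.sum_congr rfl fun k _ => by ring
  rw [e]
  have hA : 0 ≤ ∑ k, a k ^ 2 := Finset.sum_nonneg fun _ _ => sq_nonneg _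
  calc _ ≤ ∑ k, ∑ l, |a k| * |a l| * (ε * T) := by
        refine (Finset.abs_sum_le_sum_abs _ _).trans (Finset.sum_le_sum fun k _ => ?_)
        refine (Finset.abs_sum_le_sum_abs _ _).trans (Finset.sum_le_sum fun l _ => ?_)
        rw [abs_mul, abs_mul]
        gcongr
        exact h.z_z k l
    _ = (∑ k, |a k|) ^ 2 * (ε * T) := by
        rw [sq, Finset.sum_mul_sum]; simp_rw [Finset.sum_mul]
    _ ≤ (r * ∑ k, a k ^ 2) * (ε * T) := by
        have := h.T_pos; have := h.ε_pos
        gcongr; exact sq_sum_abs_le a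
    _ = (r * ε) * (T * ∑ k, a k ^ 2) := by ring
    _ ≤ 1 / 4 * (T * ∑ k, a k ^ 2) := by
        have := h.T_pos
        gcongr; exact h.r_ε
    _ = _ := by ring

lemma norm_comb_le (a : Fin r → ℝ) : ‖∑ k, a k • z k‖ ^ 2 ≤ 2 * T * ∑ k, a k ^ 2 := by
  have hA : 0 ≤ ∑ k, a k ^ 2 := Finset.sum_nonneg fun _ _ => sq_nonneg _
  have := (abs_le.1 (h.abs_norm_comb_sub_le a)).2
  nlinarith [mul_nonneg h.T_pos.le hA]

/-- Removing the observed regressors costs at most another `T / 4`, so the projected latent paths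
still span `r` dimensions. -/
lemma le_norm_proj_comb (a : Fin r → ℝ) :
    T / 2 * ∑ k, a k ^ 2 ≤ ‖Q (∑ k, a k • z k)‖ ^ 2 := by
  have hA : 0 ≤ ∑ k, a k ^ 2 := Finset.sum_nonneg fun _ _ => sq_nonneg _
  have h1 := (abs_le.1 (h.abs_norm_comb_sub_le a)).1
  have e : (∑ k, a k • z k) - Q (∑ k, a k • z k) = ∑ k, a k • (z k - Q (z k)) := by
    rw [map_sum, ← Finset.sum_sub_distrib]
    exact Finset.sum_congr rfl fun k _ => by rw [map_smul, smul_sub]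
  have h2 : ‖(∑ k, a k • z k) - Q (∑ k, a k • z k)‖ ^ 2 ≤ (∑ k, a k ^ 2) * (r * ε * T) := by
    rw [e]
    refine (norm_sum_smul_sq_le _ _).trans ?_
    gcongr
    calc _ ≤ ∑ _k : Fin r, ε * T := Finset.sum_le_sum fun k _ => h.z_sub k
      _ = _ := by simp; ring
  have h3 : (∑ k, a k ^ 2) * (r * ε * T) ≤ T / 4 * ∑ k, a k ^ 2 := by
    have := mul_le_mul_of_nonneg_right h.r_ε (mul_nonneg h.T_pos.le hA)
    nlinarith
  rw [h.norm_sq_eq]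
  linarith

lemma inner_unitResidual {x : H} (hx : Q x = x) (i : Fin n) :
    ⟪unitResidual Q b μ γ z η i, x⟫
      = μ i * ⟪b, x⟫ + ∑ k, γ i k * ⟪z k, x⟫ + ⟪η i, x⟫ := by
  rw [unitResidual, inner_add_left, real_inner_smul_left, h.symm, hx, inner_add_left, sum_inner]
  simp_rw [real_inner_smul_left]
  ring

lemma sq_sum_γ_le {f : Fin r → ℝ} {B : ℝ} (hf : ∀ k, f k ^ 2 ≤ B) (i : Fin n) :
    (∑ k, γ i k * f k) ^ 2 ≤ g * r * B := by
  have hB : 0 ≤ (r : ℝ) * B := by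
    have : ∑ k, f k ^ 2 ≤ ∑ _k : Fin r, B := Finset.sum_le_sum fun k _ => hf k
    simp only [Finset.sum_const, Finset.card_univ, Fintype.card_fin, nsmul_eq_mul] at this
    exact (Finset.sum_nonneg fun _ _ => sq_nonneg _).trans this
  calc (∑ k, γ i k * f k) ^ 2 ≤ (∑ k, γ i k ^ 2) * ∑ k, f k ^ 2 :=
        Finset.sum_mul_sq_le_sq_mul_sq _ _ _
    _ ≤ g * (∑ _k : Fin r, B) := by
        gcongr
        · exact h.g_pos.le
        · exact h.γ_le i
        · exact hf _
    _ = _ := by simp; ring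

lemma norm_b_comb_sq_le (a : Fin r → ℝ) :
    ⟪b, Q (∑ k, a k • z k)⟫ ^ 2 ≤ (∑ k, a k ^ 2) * (r * (τ ^ 2 * T)) := by
  rw [← h.symm, h.Q_b, inner_sum]
  simp_rw [real_inner_smul_right]
  refine (Finset.sum_mul_sq_le_sq_mul_sq _ _ _).trans ?_
  gcongr
  calc _ ≤ ∑ _k : Fin r, τ ^ 2 * T := Finset.sum_le_sum fun k _ => h.b_z k
    _ = _ := by simp

lemma inner_η_comb_sq_le (a : Fin r → ℝ) (i : Fin n) :
    ⟪η i, Q (∑ k, a k • z k)⟫ ^ 2 ≤ (∑ k, a k ^ 2) * (r * (2 * τ ^ 2 * T)) := by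
  rw [map_sum, inner_sum]
  simp_rw [map_smul, real_inner_smul_right]
  refine (Finset.sum_mul_sq_le_sq_mul_sq _ _ _).trans ?_
  gcongr
  calc _ ≤ ∑ _k : Fin r, 2 * τ ^ 2 * T := Finset.sum_le_sum fun k _ => by
        rw [real_inner_comm]; exact h.z_η k i
    _ = _ := by simp

/-- The Gram operator of the residuals is large on the span of the projected latent factors. -/
lemma le_sum_inner_sq (a : Fin r → ℝ) :
    s / 48 * (n * T) * ‖Q (∑ k, a k • z k)‖ ^ 2
      ≤ ∑ i, ⟪unitResidual Q b μ γ z η i, Q (∑ k, a k • z k)⟫ ^ 2 := by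
  set A := ∑ k, a k ^ 2 with hAdef
  set w := Q (∑ k, a k • z k) with hw
  have hQw : Q w = w := h.idem _
  have hA : 0 ≤ A := Finset.sum_nonneg fun _ _ => sq_nonneg _
  have hT := h.T_pos
  set c : Fin r → ℝ := fun k => ⟪z k, w⟫ with hc
  have hac : ∑ k, a k * c k = ‖w‖ ^ 2 := by
    have : ⟪∑ k, a k • z k, w⟫ = ‖w‖ ^ 2 := by
      rw [← hQw, ← h.symm, ← hw, real_inner_self_eq_norm_sq, hQw]
    rw [← this, sum_inner]
    simp_rw [real_inner_smul_left]
    rfl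
  have hwA : T / 2 * A ≤ ‖w‖ ^ 2 := h.le_norm_proj_comb a
  -- Cauchy-Schwarz applied to `∑ a_k c_k = ‖w‖² ≥ T A / 2`; the division by `A` requires treating
  -- `A = 0` apart.
  have hc2 : T ^ 2 * A / 4 ≤ ∑ k, c k ^ 2 := by
    rcases hA.eq_or_lt with h0 | h0
    · rw [← h0]; simpa using Finset.sum_nonneg fun k (_ : k ∈ Finset.univ) => sq_nonneg (c k)
    · have h1 : (∑ k, a k * c k) ^ 2 ≤ A * ∑ k, c k ^ 2 := Finset.sum_mul_sq_le_sq_mul_sq _ _ _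
      rw [hac] at h1
      have h2 : (T / 2 * A) ^ 2 ≤ (‖w‖ ^ 2) ^ 2 := by gcongr
      have h3 : A * (T ^ 2 * A / 4) ≤ A * ∑ k, c k ^ 2 := by nlinarith
      exact le_of_mul_le_mul_left h3 h0
  have hα : n * s * (T ^ 2 * A / 4) ≤ ∑ i, (∑ k, γ i k * c k) ^ 2 := by
    refine le_trans ?_ (h.le_γ c)
    have := h.s_pos
    gcongr
  have hpt : ∀ i, (∑ k, γ i k * c k) ^ 2 ≤ 3 * ⟪unitResidual Q b μ γ z η i, w⟫ ^ 2
      + 3 * (μ i ^ 2 * (A * (r * (τ ^ 2 * T)))) + 3 * (A * (r * (2 * τ ^ 2 * T))) := by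
    intro i
    have e := h.inner_unitResidual hQw i
    have h1 : (μ i * ⟪b, w⟫) ^ 2 ≤ μ i ^ 2 * (A * (r * (τ ^ 2 * T))) := by
      rw [mul_pow]; gcongr; exact h.norm_b_comb_sq_le a
    have h2 := h.inner_η_comb_sq_le a i
    have e2 : ∑ k, γ i k * c k = ⟪unitResidual Q b μ γ z η i, w⟫ - μ i * ⟪b, w⟫ - ⟪η i, w⟫ := by
      rw [e]; ring
    rw [e2]
    set x := ⟪unitResidual Q b μ γ z η i, w⟫
    set y := μ i * ⟪b, w⟫
    set u := ⟪η i, w⟫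
    nlinarith [sq_nonneg (x + y), sq_nonneg (x + u), sq_nonneg (y - u)]
  have hsum := Finset.sum_le_sum fun i (_ : i ∈ Finset.univ) => hpt i
  rw [Finset.sum_add_distrib, Finset.sum_add_distrib, ← Finset.mul_sum, ← Finset.mul_sum,
    ← Finset.sum_mul] at hsum
  simp only [Finset.sum_const, Finset.card_univ, Fintype.card_fin, nsmul_eq_mul] at hsum
  set S := ∑ i, ⟪unitResidual Q b μ γ z η i, w⟫ ^ 2
  have hwle : ‖w‖ ^ 2 ≤ 2 * T * A := by
    refine le_trans ?_ (h.norm_comb_le a)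
    have := h.norm_le (∑ k, a k • z k)
    gcongr
  have hμ : (∑ i, μ i ^ 2) * (A * (r * (τ ^ 2 * T))) ≤ n * A * T ^ 2 * (C ^ 2 * r * ε ^ 2) := by
    calc _ ≤ (C ^ 2 * n / T) * (A * (r * (ε ^ 2 * T * T))) := by
          refine mul_le_mul h.sum_μ ?_ (by positivity) (by positivity)
          gcongr
          exact h.τ_sq_le
      _ = n * A * T * (C ^ 2 * r * ε ^ 2) := by field_simp
      _ ≤ n * A * T ^ 2 * (C ^ 2 * r * ε ^ 2) := by
          gcongr
          nlinarith [h.one_le_T]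
  have hη : (n : ℝ) * (3 * (A * (r * (2 * τ ^ 2 * T)))) ≤ n * A * T ^ 2 * (6 * r * ε ^ 2) := by
    calc _ ≤ (n : ℝ) * (3 * (A * (r * (2 * (ε ^ 2 * T) * T)))) := by
          gcongr; exact h.τ_sq_le
      _ = _ := by ring
  have hsm : n * A * T ^ 2 * ((C ^ 2 + 8) * r * ε ^ 2) ≤ n * A * T ^ 2 * (s / 24) := by
    gcongr; exact h.small
  have hnn : 0 ≤ n * A * T ^ 2 * (r * ε ^ 2) := by positivity
  -- The factor part contributes at least `n s T² A / 4`. By `small`, intercepts and noise take away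
  -- at most half of it. Dividing the remaining `s / 8` by the `3` from the three-term square, and
  -- then by `2` from `‖w‖² ≤ 2 T A`, leaves `s / 48`.
  have : s / 48 * (n * T) * ‖w‖ ^ 2 ≤ s / 48 * (n * T) * (2 * T * A) := by
    have := h.s_pos
    gcongr
  nlinarith

lemma norm_η_sq_le (i : Fin n) : ‖η i‖ ^ 2 ≤ 2 * T := by
  have h1 := (abs_le.1 (h.η_η i i)).2
  rw [real_inner_self_eq_norm_sq] at h1
  have h2 := h.T_pos
  nlinarith [h.σ_diag i, h.ε_le]

lemma norm_err_sq_le (i : Fin n) : ‖Q (∑ k, γ i k • z k + η i)‖ ^ 2 ≤ 4 * (g + 1) * T := by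
  have h1 := h.norm_comb_le (γ i)
  have h2 := h.norm_η_sq_le i
  have hT := h.T_pos
  have h3 : 2 * T * ∑ k, γ i k ^ 2 ≤ 2 * T * g := by gcongr; exact h.γ_le i
  have h4 : ‖Q (∑ k, γ i k • z k + η i)‖ ≤ ‖∑ k, γ i k • z k‖ + ‖η i‖ :=
    (h.norm_le _).trans (norm_add_le _ _)
  have h5 : ‖Q (∑ k, γ i k • z k + η i)‖ ^ 2 ≤ (‖∑ k, γ i k • z k‖ + ‖η i‖) ^ 2 := by gcongr
  nlinarith [sq_nonneg (‖∑ k, γ i k • z k‖ - ‖η i‖)]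

/-- `v` lists orthonormal eigenvectors of the Gram operator of the residuals, with eigenvalues at
least `(n T) L`. -/
structure PrincipalDirections (Q : H →ₗ[ℝ] H) (b : H) (μ : Fin n → ℝ) (γ : Fin n → Fin r → ℝ)
    (z : Fin r → H) (η : Fin n → H) (T L : ℝ) (v : Fin r → H) : Prop where
  L_pos : 0 < L
  n_pos : 0 < n
  orthonormal : Orthonormal ℝ v
  eigen : ∀ j, ∃ l, L ≤ l ∧ ∀ x, n * T * l * ⟪v j, x⟫
    = ∑ i, ⟪unitResidual Q b μ γ z η i, v j⟫ * ⟪unitResidual Q b μ γ z η i, x⟫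

variable {L : ℝ} {v : Fin r → H} (hv : PrincipalDirections Q b μ γ z η T L v)
include hv

/-- The eigenvector equation expresses `⟪v j, x⟫` through the inner products of `x` with the
residuals. Since `∑ ⟪R i, v j⟫²` is the eigenvalue itself, Cauchy-Schwarz loses only one factor of
it. Any vector that is nearly orthogonal to the residuals on average is therefore nearly orthogonal
to the principal directions. -/
lemma inner_direction_sq_le (x : H) (j : Fin r) {K : ℝ}
    (hK : ∑ i, ⟪unitResidual Q b μ γ z η i, x⟫ ^ 2 ≤ n * T * K) : ⟪v j, x⟫ ^ 2 ≤ K / L := by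
  obtain ⟨l, hl, he⟩ := hv.eigen j
  have hL := hv.L_pos
  have hT := h.T_pos
  have hn : (0 : ℝ) < n := by exact_mod_cast hv.n_pos
  have hlp : 0 < l := hL.trans_le hl
  set R := unitResidual Q b μ γ z η
  have h1 : ∑ i, ⟪R i, v j⟫ ^ 2 = n * T * l := by
    have := he (v j)
    rw [real_inner_self_eq_norm_sq, hv.orthonormal.1 j] at this
    simp only [← sq, one_pow, mul_one] at this
    exact this.symm
  have h2 : (n * T * l * ⟪v j, x⟫) ^ 2 ≤ (n * T * l) * (n * T * K) := by
    rw [he x, ← h1]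
    refine (Finset.sum_mul_sq_le_sq_mul_sq _ _ _).trans ?_
    gcongr
  have hp : 0 < (n * T) ^ 2 * l := by positivity
  have h3 : (n * T) ^ 2 * l * (l * ⟪v j, x⟫ ^ 2) ≤ (n * T) ^ 2 * l * K := by
    calc _ = (n * T * l * ⟪v j, x⟫) ^ 2 := by ring
      _ ≤ _ := h2
      _ = _ := by ring
  have h4 := le_of_mul_le_mul_left h3 hp
  rw [le_div_iff₀ hL]
  nlinarith [sq_nonneg ⟪v j, x⟫, mul_le_mul_of_nonneg_right hl (sq_nonneg ⟪v j, x⟫)]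

/-- The dangerous term is `μ i ‖b‖²`, as large as `μ i T`. Its squares sum to at most `C² n T`,
which is within the allowed order `n T τ²`, because `∑ μ i² ≤ C² n / T`. -/
lemma inner_direction_b_sq_le (j : Fin r) :
    ⟪v j, b⟫ ^ 2 ≤ 3 * (C ^ 2 + g * r + 1) / L * τ ^ 2 := by
  have hT := h.T_pos
  have hg := h.g_pos
  have key : ∑ i, ⟪unitResidual Q b μ γ z η i, b⟫ ^ 2
      ≤ n * T * (3 * (C ^ 2 + g * r + 1) * τ ^ 2) := by
    have hpt : ∀ i, ⟪unitResidual Q b μ γ z η i, b⟫ ^ 2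
        ≤ μ i ^ 2 * (3 * T ^ 2) + 3 * (g * r * (τ ^ 2 * T) + τ ^ 2 * T) := by
      intro i
      rw [h.inner_unitResidual h.Q_b]
      have h1 : (μ i * ⟪b, b⟫) ^ 2 ≤ μ i ^ 2 * T ^ 2 := by
        rw [mul_pow, real_inner_self_eq_norm_sq]; gcongr; exact h.norm_b
      have h2 := h.sq_sum_γ_le (f := fun k => ⟪z k, b⟫) (B := τ ^ 2 * T)
        (fun k => by rw [real_inner_comm]; exact h.b_z k) i
      have h3 : ⟪η i, b⟫ ^ 2 ≤ τ ^ 2 * T := by rw [real_inner_comm]; exact h.b_η i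
      set x := μ i * ⟪b, b⟫
      set y := ∑ k, γ i k * ⟪z k, b⟫
      set u := ⟪η i, b⟫
      nlinarith [sq_nonneg (x - y), sq_nonneg (x - u), sq_nonneg (y - u)]
    have hsum := Finset.sum_le_sum fun i (_ : i ∈ Finset.univ) => hpt i
    rw [Finset.sum_add_distrib, ← Finset.sum_mul] at hsum
    simp only [Finset.sum_const, Finset.card_univ, Fintype.card_fin, nsmul_eq_mul] at hsum
    have h4 : (∑ i, μ i ^ 2) * (3 * T ^ 2) ≤ n * T * (3 * C ^ 2) := by
      calc _ ≤ (C ^ 2 * n / T) * (3 * T ^ 2) := by gcongr; exact h.sum_μ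
        _ = _ := by field_simp
    have h5 : n * T * (3 * C ^ 2) ≤ n * T * (3 * C ^ 2 * τ ^ 2) := by
      have h7 := h.one_le_τ
      have : (1 : ℝ) ≤ τ ^ 2 := by nlinarith
      have h8 : 0 ≤ n * T * (3 * C ^ 2) := by positivity
      nlinarith
    linarith
  refine (h.inner_direction_sq_le hv b j key).trans_eq ?_
  ring

/-- The inner products `⟪η k, Q (η i)⟫` are close to `T σ k i`, and the bound on the rows of `σ`
makes their squares sum to order `n ε² T²`. Compared with `‖Q (η i)‖²`, of order at most `T`, the
overlap with the principal directions carries the small factor `ε²`. -/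
lemma inner_direction_η_sq_le (j : Fin r) (i : Fin n) :
    ⟪v j, Q (η i)⟫ ^ 2 ≤ 3 * (C ^ 2 + 2 * g * r + 10) / L * (ε ^ 2 * T) := by
  have hT := h.T_pos
  have hg := h.g_pos
  have hε := h.ε_pos
  have hτ : τ ^ 2 ≤ ε ^ 2 * T := h.τ_sq_le
  have key : ∑ k, ⟪unitResidual Q b μ γ z η k, Q (η i)⟫ ^ 2
      ≤ n * T * (3 * (C ^ 2 + 2 * g * r + 10) * (ε ^ 2 * T)) := by
    have hpt : ∀ k, ⟪unitResidual Q b μ γ z η k, Q (η i)⟫ ^ 2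
        ≤ μ k ^ 2 * (3 * (ε ^ 2 * T * T)) + σ k i ^ 2 * (6 * T ^ 2)
          + (3 * (g * r * (2 * (ε ^ 2 * T) * T)) + 24 * (ε ^ 2 * T ^ 2)) := by
      intro k
      rw [h.inner_unitResidual (h.idem _)]
      have h1 : (μ k * ⟪b, Q (η i)⟫) ^ 2 ≤ μ k ^ 2 * (ε ^ 2 * T * T) := by
        rw [mul_pow, ← h.symm, h.Q_b]
        gcongr
        exact (h.b_η i).trans (by gcongr)
      have h2 := h.sq_sum_γ_le (f := fun l => ⟪z l, Q (η i)⟫) (B := 2 * (ε ^ 2 * T) * T)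
        (fun l => by rw [← h.symm]; exact (h.z_η l i).trans (by gcongr)) k
      have h3 : ⟪η k, Q (η i)⟫ ^ 2 ≤ 2 * (T ^ 2 * σ k i ^ 2) + 8 * (ε ^ 2 * T ^ 2) := by
        -- As `Q` is an orthogonal projection, the effect of `Q` is the inner product of the two
        -- complementary components, each of squared norm at most `ε T`.
        have e : ⟪η k, Q (η i)⟫ = T * σ k i + (⟪η k, η i⟫ - T * σ k i)
            - ⟪η k - Q (η k), η i - Q (η i)⟫ := by
          have e1 : ⟪Q (η k), η i⟫ = ⟪η k, Q (η i)⟫ := h.symm _ _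
          have e2 : ⟪Q (η k), Q (η i)⟫ = ⟪η k, Q (η i)⟫ := by rw [h.symm, h.idem]
          rw [inner_sub_left, inner_sub_right, inner_sub_right, e1, e2]; ring
        have b1 := h.η_η k i
        have b2 : |⟪η k - Q (η k), η i - Q (η i)⟫| ≤ ε * T := by
          refine (abs_real_inner_le_norm _ _).trans ?_
          nlinarith [h.η_sub k, h.η_sub i, sq_nonneg (‖η k - Q (η k)‖ - ‖η i - Q (η i)‖)]
        rw [e]
        set x := ⟪η k, η i⟫ - T * σ k i
        set y := ⟪η k - Q (η k), η i - Q (η i)⟫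
        have hxy : (x - y) ^ 2 ≤ (2 * (ε * T)) ^ 2 := by
          rw [← sq_abs]
          gcongr
          exact (abs_sub _ _).trans (by linarith)
        nlinarith [sq_nonneg (T * σ k i - (x - y))]
      set x := μ k * ⟪b, Q (η i)⟫
      set y := ∑ l, γ k l * ⟪z l, Q (η i)⟫
      set u := ⟪η k, Q (η i)⟫
      nlinarith [sq_nonneg (x - y), sq_nonneg (x - u), sq_nonneg (y - u)]
    have hsum := Finset.sum_le_sum fun k (_ : k ∈ Finset.univ) => hpt k
    rw [Finset.sum_add_distrib, Finset.sum_add_distrib, ← Finset.sum_mul, ← Finset.sum_mul] at hsum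
    simp only [Finset.sum_const, Finset.card_univ, Fintype.card_fin, nsmul_eq_mul] at hsum
    have h4 : (∑ i, μ i ^ 2) * (3 * (ε ^ 2 * T * T)) ≤ n * T * (3 * C ^ 2 * (ε ^ 2 * T)) := by
      calc _ ≤ (C ^ 2 * n / T) * (3 * (ε ^ 2 * T * T)) := by gcongr; exact h.sum_μ
        _ = n * (3 * C ^ 2 * (ε ^ 2 * T)) * 1 := by field_simp
        _ ≤ n * (3 * C ^ 2 * (ε ^ 2 * T)) * T := by gcongr; exact h.one_le_T
        _ = _ := by ring
    have h5 : (∑ k, σ k i ^ 2) * (6 * T ^ 2) ≤ ε ^ 2 * n * (6 * T ^ 2) := by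
      gcongr; exact h.σ_row i
    nlinarith
  refine (h.inner_direction_sq_le hv _ j key).trans_eq ?_
  ring

end

end RegularSample

/-- The component of `x` orthogonal to the orthonormal vectors `v`. -/
def rejection {r : ℕ} (v : Fin r → H) (x : H) : H := x - ∑ j, ⟪v j, x⟫ • v j

lemma inner_rejection {r : ℕ} (v : Fin r → H) (x y : H) :
    ⟪y, rejection v x⟫ = ⟪y, x⟫ - ∑ j, ⟪v j, x⟫ * ⟪v j, y⟫ := by
  rw [rejection, inner_sub_right, inner_sum]
  simp_rw [real_inner_smul_right, real_inner_comm y]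

lemma norm_rejection_le {r : ℕ} {v : Fin r → H} (hv : Orthonormal ℝ v) (x : H) :
    ‖rejection v x‖ ≤ ‖x‖ := by
  have h1 : ∀ j, ⟪v j, rejection v x⟫ = 0 := by
    intro j
    rw [inner_rejection]
    simp [orthonormal_iff_ite.1 hv]
  have h2 : ⟪rejection v x, rejection v x⟫ = ⟪rejection v x, x⟫ := by
    rw [inner_rejection v x (rejection v x)]
    simp [h1]
  have h3 := real_inner_le_norm (rejection v x) x
  rw [← h2, real_inner_self_eq_norm_sq] at h3
  by_contra! hlt
  nlinarith [norm_nonneg x]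

lemma sum_mul_inner_sq_le {r : ℕ} {v : Fin r → H} (hv : Orthonormal ℝ v) (x y : H) :
    (∑ j, ⟪v j, x⟫ * ⟪v j, y⟫) ^ 2 ≤ ‖x‖ ^ 2 * ∑ j, ⟪v j, y⟫ ^ 2 := by
  refine (Finset.sum_mul_sq_le_sq_mul_sq _ _ _).trans ?_
  have := hv.sum_inner_products_le x (s := Finset.univ)
  simp only [Real.norm_eq_abs, sq_abs] at this
  gcongr

namespace RegularSample

variable {n r : ℕ} {Q : H →ₗ[ℝ] H} {b : H} {μ : Fin n → ℝ} {γ : Fin n → Fin r → ℝ}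
  {z : Fin r → H} {η : Fin n → H} {σ : Fin n → Fin n → ℝ} {T τ ε g s C : ℝ}
  (h : RegularSample Q b μ γ z η σ T τ ε g s C)
  {L : ℝ} {v : Fin r → H} (hv : PrincipalDirections Q b μ γ z η T L v)
include h hv

lemma sum_inner_direction_b_sq_le :
    ∑ j, ⟪v j, b⟫ ^ 2 ≤ r * (3 * (C ^ 2 + g * r + 1) / L) * τ ^ 2 := by
  calc _ ≤ ∑ _j : Fin r, 3 * (C ^ 2 + g * r + 1) / L * τ ^ 2 :=
        Finset.sum_le_sum fun j _ => h.inner_direction_b_sq_le hv j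
    _ = _ := by simp; ring

lemma sum_inner_direction_η_sq_le (i : Fin n) :
    ∑ j, ⟪v j, Q (η i)⟫ ^ 2 ≤ r * (3 * (C ^ 2 + 2 * g * r + 10) / L) * (ε ^ 2 * T) := by
  calc _ ≤ ∑ _j : Fin r, 3 * (C ^ 2 + 2 * g * r + 10) / L * (ε ^ 2 * T) :=
        Finset.sum_le_sum fun j _ => h.inner_direction_η_sq_le hv j i
    _ = _ := by simp; ring

/-- The numerator of the test statistic is the intercept times a factor of order `T`, up to a
fluctuation of order `τ √T`. -/
lemma inner_rejection_sub_sq_le (i : Fin n) :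
    (⟪b, rejection v (unitResidual Q b μ γ z η i)⟫ - μ i * (‖b‖ ^ 2 - ∑ j, ⟪v j, b⟫ ^ 2)) ^ 2
      ≤ (4 * (g * r + 1) + 8 * (g + 1) * (r * (3 * (C ^ 2 + g * r + 1) / L))) * (τ ^ 2 * T) := by
  set x := Q (∑ k, γ i k • z k + η i) with hx
  have hg := h.g_pos
  have hT := h.T_pos
  -- The intercept part separates exactly. What remains is a direct fluctuation `⟪b, x⟫` and a
  -- leakage term through `v`, in which `‖x‖` is of order `√T` and `⟪v j, b⟫` of order `τ`.
  have e1 : ⟪b, rejection v (unitResidual Q b μ γ z η i)⟫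
      - μ i * (‖b‖ ^ 2 - ∑ j, ⟪v j, b⟫ ^ 2) = ⟪b, x⟫ - ∑ j, ⟪v j, x⟫ * ⟪v j, b⟫ := by
    rw [inner_rejection, unitResidual, ← hx]
    simp_rw [inner_add_right, real_inner_smul_right, add_mul, Finset.sum_add_distrib,
      real_inner_self_eq_norm_sq, mul_sub, Finset.mul_sum]
    have : ∑ j, μ i * ⟪v j, b⟫ * ⟪v j, b⟫ = ∑ j, μ i * ⟪v j, b⟫ ^ 2 :=
      Finset.sum_congr rfl fun _ _ => by ring
    rw [this]; ring
  have e2 : ⟪b, x⟫ = ∑ k, γ i k * ⟪b, z k⟫ + ⟪b, η i⟫ := by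
    rw [hx, ← h.symm, h.Q_b, inner_add_right, inner_sum]
    simp_rw [real_inner_smul_right]
  have b1 := h.sq_sum_γ_le h.b_z i
  have b2 := h.b_η i
  have b3 := sum_mul_inner_sq_le hv.orthonormal x b
  have b4 : ‖x‖ ^ 2 * ∑ j, ⟪v j, b⟫ ^ 2
      ≤ (4 * (g + 1) * T) * (r * (3 * (C ^ 2 + g * r + 1) / L) * τ ^ 2) := by
    gcongr
    · exact h.norm_err_sq_le i
    · exact h.sum_inner_direction_b_sq_le hv
  rw [e1, e2]
  set u := ∑ k, γ i k * ⟪b, z k⟫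
  set w := ⟪b, η i⟫
  set y := ∑ j, ⟪v j, x⟫ * ⟪v j, b⟫
  nlinarith [sq_nonneg (u + w + y), sq_nonneg (u - w)]

lemma norm_rejection_unitResidual_le (i : Fin n) :
    ‖rejection v (unitResidual Q b μ γ z η i)‖ ≤ (|μ i| + √(4 * (g + 1))) * √T := by
  refine (norm_rejection_le hv.orthonormal _).trans ((norm_add_le _ _).trans ?_)
  have hT := h.T_pos
  have hb : ‖b‖ ≤ √T := Real.le_sqrt_of_sq_le h.norm_b
  have hE := Real.le_sqrt_of_sq_le (h.norm_err_sq_le i)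
  rw [Real.sqrt_mul (by have := h.g_pos; positivity)] at hE
  rw [norm_smul, Real.norm_eq_abs, add_mul]
  gcongr

/-- The estimated idiosyncratic variances of null units are bounded from below. -/
lemma le_norm_rejection_sq {i : Fin n} (hμ : μ i = 0) {σ₀ : ℝ} (hσ : σ₀ ^ 2 ≤ σ i i)
    (hε : ε * (2 + √(2 * g * r)
      + √(4 * (g + 1) * (r * (3 * (C ^ 2 + 2 * g * r + 10) / L)))) ≤ σ₀ ^ 2 / 2) :
    σ₀ ^ 4 / 8 * T ≤ ‖rejection v (unitResidual Q b μ γ z η i)‖ ^ 2 := by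
  set x := Q (∑ k, γ i k • z k + η i) with hx
  have hR : unitResidual Q b μ γ z η i = x := by rw [unitResidual, hμ, zero_smul, zero_add]
  rw [hR]
  have hg := h.g_pos
  have hT := h.T_pos
  have hεp := h.ε_pos
  have hL := hv.L_pos
  -- The norm of the rejection is bounded from below by testing it against the projected noise `y`:
  -- neither the latent paths nor the directions `v` correlate much with `y`, so the inner product
  -- is at least `σ₀² T / 2`. With `‖y‖² ≤ 2 T` this gives `σ₀⁴ / 8`.
  set y := Q (η i) with hy
  have e0 : ⟪y, x⟫ = ‖y‖ ^ 2 + ∑ k, γ i k * ⟪Q (z k), η i⟫ := by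
    have e1 : ⟪Q (η i), η i⟫ = ‖y‖ ^ 2 := by
      rw [← real_inner_self_eq_norm_sq, hy, h.symm (η i) (Q (η i)), h.idem, h.symm]
    rw [hx, ← h.symm, hy, h.idem, inner_add_right, inner_sum, e1, add_comm]
    simp_rw [real_inner_smul_right]
    exact congrArg₂ _ rfl (Finset.sum_congr rfl fun k _ => by rw [h.symm, real_inner_comm])
  have b0 : (σ₀ ^ 2 - 2 * ε) * T ≤ ‖y‖ ^ 2 := by
    have h1 := (abs_le.1 (h.η_η i i)).1
    rw [real_inner_self_eq_norm_sq] at h1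
    rw [hy, h.norm_sq_eq]
    nlinarith [h.η_sub i]
  have b1 : |∑ k, γ i k * ⟪Q (z k), η i⟫| ≤ ε * √(2 * g * r) * T := by
    apply abs_le_of_sq_le_sq _ (by positivity)
    refine (h.sq_sum_γ_le (fun k => h.z_η k i) i).trans ?_
    rw [mul_pow, mul_pow, Real.sq_sqrt (by positivity)]
    calc _ ≤ g * r * (2 * (ε ^ 2 * T) * T) := by gcongr; exact h.τ_sq_le
      _ = _ := by ring
  have b2 : |∑ j, ⟪v j, x⟫ * ⟪v j, y⟫|
      ≤ ε * √(4 * (g + 1) * (r * (3 * (C ^ 2 + 2 * g * r + 10) / L))) * T := by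
    apply abs_le_of_sq_le_sq _ (by positivity)
    refine (sum_mul_inner_sq_le hv.orthonormal x y).trans ?_
    rw [mul_pow, mul_pow, Real.sq_sqrt (by positivity)]
    calc _ ≤ (4 * (g + 1) * T) * (r * (3 * (C ^ 2 + 2 * g * r + 10) / L) * (ε ^ 2 * T)) := by
          gcongr
          · exact h.norm_err_sq_le i
          · exact h.sum_inner_direction_η_sq_le hv i
      _ = _ := by ring
  have b3 : σ₀ ^ 2 / 2 * T ≤ ⟪y, rejection v x⟫ := by
    rw [inner_rejection, e0]
    have := (abs_le.1 b1).1
    have := (abs_le.1 b2).2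
    nlinarith [mul_le_mul_of_nonneg_right hε hT.le]
  have b4 : ‖y‖ ^ 2 ≤ 2 * T := by
    refine le_trans ?_ (h.norm_η_sq_le i)
    have := h.norm_le (η i)
    gcongr
  have b5 : (σ₀ ^ 2 / 2 * T) ^ 2 ≤ 2 * T * ‖rejection v x‖ ^ 2 := by
    calc _ ≤ (‖y‖ * ‖rejection v x‖) ^ 2 := by
          exact pow_le_pow_left₀ (by positivity) (b3.trans (real_inner_le_norm _ _)) 2
      _ = ‖y‖ ^ 2 * ‖rejection v x‖ ^ 2 := by ring
      _ ≤ _ := by gcongr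
  have b6 : 2 * T * (σ₀ ^ 4 / 8 * T) ≤ 2 * T * ‖rejection v x‖ ^ 2 := by
    calc _ = (σ₀ ^ 2 / 2 * T) ^ 2 := by ring
      _ ≤ _ := b5
  exact le_of_mul_le_mul_left b6 (by positivity)

end RegularSample

end Core

/-! ### From the matrix formulas of the estimators to the inner product space. -/

section Bridge

lemma annihilator_transpose {n k : ℕ} (A : Matrix (Fin n) (Fin k) ℝ) :
    (annihilator A)ᵀ = annihilator A := by
  have h : ((Aᵀ * A)⁻¹)ᵀ = (Aᵀ * A)⁻¹ := by
    rw [Matrix.transpose_nonsing_inv, Matrix.transpose_mul, Matrix.transpose_transpose]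
  simp only [annihilator, Matrix.transpose_sub, Matrix.transpose_one, Matrix.transpose_mul,
    Matrix.transpose_transpose, h, Matrix.mul_assoc]

lemma annihilator_mul_self {n k : ℕ} (A : Matrix (Fin n) (Fin k) ℝ) :
    annihilator A * annihilator A = annihilator A := by
  by_cases hu : IsUnit (Aᵀ * A).det
  · have : A * (Aᵀ * A)⁻¹ * Aᵀ * (A * (Aᵀ * A)⁻¹ * Aᵀ) = A * (Aᵀ * A)⁻¹ * Aᵀ := by
      calc _ = A * ((Aᵀ * A)⁻¹ * (Aᵀ * A)) * (Aᵀ * A)⁻¹ * Aᵀ := by simp only [Matrix.mul_assoc]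
        _ = _ := by rw [Matrix.nonsing_inv_mul _ hu, Matrix.mul_one]
    simp only [annihilator, Matrix.sub_mul, Matrix.mul_sub, Matrix.one_mul, Matrix.mul_one, this]
    abel
  -- A singular Gram matrix has inverse `0` by convention, and the annihilator is then the identity.
  · simp [annihilator, Matrix.nonsing_inv_apply_not_isUnit _ hu]

lemma annihilator_mul_design {n k : ℕ} {A : Matrix (Fin n) (Fin k) ℝ}
    (hu : IsUnit (Aᵀ * A).det) : annihilator A * A = 0 := by
  rw [annihilator, Matrix.sub_mul, Matrix.one_mul, Matrix.mul_assoc, Matrix.mul_assoc,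
    Matrix.nonsing_inv_mul _ hu, Matrix.mul_one, sub_self]

lemma trace_one_sub_annihilator {n k : ℕ} {A : Matrix (Fin n) (Fin k) ℝ}
    (hu : IsUnit (Aᵀ * A).det) : (1 - annihilator A).trace = k := by
  rw [annihilator, sub_sub_cancel, Matrix.trace_mul_comm, ← Matrix.mul_assoc,
    Matrix.mul_nonsing_inv _ hu, Matrix.trace_one, Fintype.card_fin]

variable {T : ℕ}

lemma inner_toLp (x y : Fin T → ℝ) : ⟪WithLp.toLp 2 x, WithLp.toLp 2 y⟫ = x ⬝ᵥ y := by
  rw [EuclideanSpace.inner_toLp_toLp, star_trivial, dotProduct_comm]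

/-- The annihilator as an operator on Euclidean space. -/
def proj {k : ℕ} (A : Matrix (Fin T) (Fin k) ℝ) :
    EuclideanSpace ℝ (Fin T) →ₗ[ℝ] EuclideanSpace ℝ (Fin T) :=
  Matrix.toEuclideanLin (annihilator A)

lemma proj_toLp {k : ℕ} (A : Matrix (Fin T) (Fin k) ℝ) (x : Fin T → ℝ) :
    proj A (WithLp.toLp 2 x) = WithLp.toLp 2 (annihilator A *ᵥ x) := rfl

lemma proj_symm {k : ℕ} (A : Matrix (Fin T) (Fin k) ℝ) (x y : EuclideanSpace ℝ (Fin T)) :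
    ⟪proj A x, y⟫ = ⟪x, proj A y⟫ := by
  have : ∀ x y : Fin T → ℝ, ⟪proj A (WithLp.toLp 2 x), WithLp.toLp 2 y⟫
      = ⟪WithLp.toLp 2 x, proj A (WithLp.toLp 2 y)⟫ := by
    intro x y
    rw [proj_toLp, proj_toLp, inner_toLp, inner_toLp, Matrix.dotProduct_mulVec,
      ← Matrix.mulVec_transpose, annihilator_transpose]
  exact this x.ofLp y.ofLp

lemma proj_proj {k : ℕ} (A : Matrix (Fin T) (Fin k) ℝ) (x : EuclideanSpace ℝ (Fin T)) :
    proj A (proj A x) = proj A x := by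
  have : ∀ x : Fin T → ℝ, proj A (proj A (WithLp.toLp 2 x)) = proj A (WithLp.toLp 2 x) := by
    intro x
    rw [proj_toLp, proj_toLp, Matrix.mulVec_mulVec, annihilator_mul_self]
  exact this x.ofLp

/-- The residual of the constant regressor. -/
def residualOne {k : ℕ} (A : Matrix (Fin T) (Fin k) ℝ) : EuclideanSpace ℝ (Fin T) :=
  proj A (WithLp.toLp 2 1)

lemma norm_residualOne_sq {k : ℕ} (A : Matrix (Fin T) (Fin k) ℝ) :
    ‖residualOne A‖ ^ 2 = oneQone A := by
  rw [← real_inner_self_eq_norm_sq, residualOne, proj_symm, proj_proj, proj_toLp, inner_toLp,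
    oneQone]

lemma residual_apply {n k : ℕ} (X : Matrix (Fin T) (Fin k) ℝ) (Y : Matrix (Fin n) (Fin T) ℝ)
    (i : Fin n) : residual X Y i = annihilator X *ᵥ Y i := rfl

lemma factorHat_gram {r : ℕ} {v : Fin r → EuclideanSpace ℝ (Fin T)} (hv : Orthonormal ℝ v) :
    (factorHat v)ᵀ * factorHat v = (T : ℝ) • (1 : Matrix (Fin r) (Fin r) ℝ) := by
  ext j k
  have h1 := orthonormal_iff_ite.1 hv j k
  rw [show ⟪v j, v k⟫ = (v j).ofLp ⬝ᵥ (v k).ofLp from inner_toLp _ _] at h1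
  simp only [Matrix.mul_apply, Matrix.transpose_apply, factorHat, Matrix.of_apply,
    Matrix.smul_apply, Matrix.one_apply, smul_eq_mul]
  rw [← h1, dotProduct, Finset.mul_sum]
  refine Finset.sum_congr rfl fun t _ => ?_
  rw [mul_mul_mul_comm, Real.mul_self_sqrt (Nat.cast_nonneg T)]

lemma annihilator_factorHat_mulVec {r : ℕ} (hT : 0 < T) {v : Fin r → EuclideanSpace ℝ (Fin T)}
    (hv : Orthonormal ℝ v) (x : Fin T → ℝ) :
    annihilator (factorHat v) *ᵥ x = (rejection v (WithLp.toLp 2 x)).ofLp := by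
  have hT' : (T : ℝ) ≠ 0 := by positivity
  have hinv : ((factorHat v)ᵀ * factorHat v)⁻¹ = (T : ℝ)⁻¹ • (1 : Matrix (Fin r) (Fin r) ℝ) := by
    rw [factorHat_gram hv]
    apply Matrix.inv_eq_right_inv
    rw [Matrix.smul_mul, Matrix.mul_smul, Matrix.mul_one, smul_smul, mul_inv_cancel₀ hT', one_smul]
  have h1 : ∀ j, ⟪v j, WithLp.toLp 2 x⟫ = (v j).ofLp ⬝ᵥ x := fun j => inner_toLp _ _
  rw [annihilator, hinv, Matrix.sub_mulVec, Matrix.one_mulVec, rejection, WithLp.ofLp_sub,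
    WithLp.ofLp_sum]
  congr 1
  ext t
  rw [Matrix.mul_smul, Matrix.mul_one, Matrix.smul_mul, Matrix.smul_mulVec, ← Matrix.mulVec_mulVec]
  simp only [Pi.smul_apply, Finset.sum_apply, WithLp.ofLp_smul, smul_eq_mul, h1]
  simp only [Matrix.mulVec, dotProduct, factorHat, Matrix.transpose_apply, Matrix.of_apply]
  rw [Finset.mul_sum]
  refine Finset.sum_congr rfl fun j _ => ?_
  have : ∑ s, √(T : ℝ) * (v j).ofLp s * x s = √(T : ℝ) * ∑ s, (v j).ofLp s * x s := by
    rw [Finset.mul_sum]; exact Finset.sum_congr rfl fun s _ => by ring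
  rw [this]
  calc _ = (T : ℝ)⁻¹ * (√(T : ℝ) * √(T : ℝ)) * ((v j).ofLp t * ∑ s, (v j).ofLp s * x s) := by ring
    _ = _ := by rw [Real.mul_self_sqrt (Nat.cast_nonneg T), inv_mul_cancel₀ hT', one_mul, mul_comm]

/-- The fitted factor part is the residual minus its rejection, and the residual is fixed by the
annihilator. Subtracting the fit in the numerator therefore leaves `1ᵀ Q` applied to the rejection,
while the estimated variance is the squared norm of the same rejection over `T`. -/
lemma testStat_eq {n k r : ℕ} (hT : 0 < T) (X : Matrix (Fin T) (Fin k) ℝ)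
    (Y : Matrix (Fin n) (Fin T) ℝ) {v : Fin r → EuclideanSpace ℝ (Fin T)} (hv : Orthonormal ℝ v)
    (i : Fin n) :
    testStat X Y v i = √(T : ℝ) / √(oneQone X) *
      (⟪residualOne X, rejection v (WithLp.toLp 2 (residual X Y i))⟫ /
        ‖rejection v (WithLp.toLp 2 (residual X Y i))‖) := by
  set R := residual X Y i with hR
  set M := rejection v (WithLp.toLp 2 R) with hM
  have hMeq : annihilator (factorHat v) *ᵥ R = M.ofLp := annihilator_factorHat_mulVec hT hv R
  have hnoise : noiseHat X Y v i = M.ofLp := hMeq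
  have hfit : factorHat v *ᵥ loadingHat X Y v i = R - M.ofLp := by
    have : loadingHat X Y v i
        = (((factorHat v)ᵀ * factorHat v)⁻¹ * (factorHat v)ᵀ) *ᵥ R := rfl
    rw [this, Matrix.mulVec_mulVec, ← Matrix.mul_assoc, ← hMeq, annihilator, Matrix.sub_mulVec,
      Matrix.one_mulVec, sub_sub_cancel]
  have hAR : annihilator X *ᵥ R = R := by
    rw [hR, residual_apply, Matrix.mulVec_mulVec, annihilator_mul_self]
  have hinner : ⟪residualOne X, M⟫ = (1 : Fin T → ℝ) ⬝ᵥ (annihilator X *ᵥ M.ofLp) := by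
    rw [residualOne, proj_symm]; exact inner_toLp _ _
  have hnorm : M.ofLp ⬝ᵥ M.ofLp = ‖M‖ ^ 2 := by
    rw [← real_inner_self_eq_norm_sq]; exact (inner_toLp _ _).symm
  have hsig : √(sigmaHat X Y v i) = ‖M‖ / √(T : ℝ) := by
    rw [sigmaHat, hnoise, hnorm, Real.sqrt_mul (by positivity), Real.sqrt_sq (norm_nonneg _),
      Real.sqrt_inv]
    ring
  have hmu : √(oneQone X) * muHat X Y i = (√(oneQone X))⁻¹ * ((1 : Fin T → ℝ) ⬝ᵥ R) := by
    rw [muHat, ← mul_assoc, ← residual_apply, ← hR]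
    congr 1
    rw [← div_eq_mul_inv, Real.sqrt_div_self]
  rw [testStat, hsig, hmu, hfit, Matrix.mulVec_sub, hAR, dotProduct_sub, ← hinner]
  have : (0 : ℝ) < √(T : ℝ) := by positivity
  field_simp
  ring

/-- Courant-Fischer lower bound for the eigenvalues of leading eigenvectors. -/
lemma IsLeadingEigenvectors.exists_eigenvalue {r : ℕ} {A : Matrix (Fin T) (Fin T) ℝ}
    {v : Fin r → EuclideanSpace ℝ (Fin T)} (hv : IsLeadingEigenvectors A v) {L : ℝ}
    (W : (Fin r → ℝ) →ₗ[ℝ] EuclideanSpace ℝ (Fin T)) (hW : Function.Injective W)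
    (hL : ∀ a, L * ‖W a‖ ^ 2 ≤ ⟪W a, Matrix.toEuclideanLin A (W a)⟫) :
    Orthonormal ℝ v ∧ ∀ j, ∃ l, L ≤ l ∧ Matrix.toEuclideanLin A (v j) = l • v j := by
  obtain ⟨hrT, b, l, hl, hb, hvb⟩ := hv
  have hb' : ∀ i, Matrix.toEuclideanLin A (b i) = l i • b i := by
    intro i
    have : Matrix.toEuclideanLin A (b i) = WithLp.toLp 2 (A *ᵥ (b i).ofLp) := rfl
    rw [this, hb]; rfl
  refine ⟨?_, fun j => ⟨l (Fin.castLE hrT j), ?_, by rw [hvb, hb']⟩⟩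
  · have : v = b ∘ Fin.castLE hrT := funext hvb
    rw [this]
    exact b.orthonormal.comp _ (Fin.castLE_injective hrT)
  -- Dimension count: orthogonality to the eigenvectors before the `j`-th (zero-based) imposes `j <
  -- r` linear conditions on an `r`-dimensional space. For such a vector the Rayleigh quotient is at
  -- most the eigenvalue of index `j`.
  obtain ⟨a, ha0, ha⟩ : ∃ a : Fin r → ℝ, a ≠ 0 ∧ ∀ k : Fin T, k < Fin.castLE hrT j →
      ⟪b k, W a⟫ = 0 := by
    let F : (Fin r → ℝ) →ₗ[ℝ] (Fin (j : ℕ) → ℝ) :=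
      { toFun := fun a k => ⟪b ⟨k, k.2.trans (j.2.trans_le hrT)⟩, W a⟫
        map_add' := fun a a' => by ext k; simp [inner_add_right]
        map_smul' := fun c a => by ext k; simp [real_inner_smul_right] }
    have hdim : Module.finrank ℝ (Fin (j : ℕ) → ℝ) < Module.finrank ℝ (Fin r → ℝ) := by simp
    obtain ⟨a, ha, ha0⟩ := (Submodule.ne_bot_iff _).1 (LinearMap.ker_ne_bot_of_finrank_lt (f := F) hdim)
    refine ⟨a, ha0, fun k hk => ?_⟩
    exact congrFun (LinearMap.mem_ker.1 ha) ⟨k, hk⟩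
  set w := W a
  have hw0 : w ≠ 0 := fun h0 => ha0 (hW (by rw [map_zero]; exact h0))
  have hexp : ⟪w, Matrix.toEuclideanLin A w⟫ = ∑ i, l i * ⟪b i, w⟫ ^ 2 := by
    conv_lhs => rw [← b.sum_repr' w]
    rw [map_sum, b.sum_repr' w, inner_sum]
    refine Finset.sum_congr rfl fun i _ => ?_
    rw [map_smul, hb', real_inner_smul_right, real_inner_smul_right, real_inner_comm w]; ring
  have hnorm : ‖w‖ ^ 2 = ∑ i, ⟪b i, w⟫ ^ 2 := by
    rw [← b.sum_sq_norm_inner_right w]; simp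
  have hle : ⟪w, Matrix.toEuclideanLin A w⟫ ≤ l (Fin.castLE hrT j) * ‖w‖ ^ 2 := by
    rw [hexp, hnorm, Finset.mul_sum]
    refine Finset.sum_le_sum fun i _ => ?_
    rcases lt_or_ge i (Fin.castLE hrT j) with h | h
    · rw [ha i h]; simp
    · gcongr; exact hl h
  have := (hL a).trans hle
  exact le_of_mul_le_mul_right this (by positivity)

lemma inner_pcaMatrix {n k : ℕ} (X : Matrix (Fin T) (Fin k) ℝ) (Y : Matrix (Fin n) (Fin T) ℝ)
    (x y : EuclideanSpace ℝ (Fin T)) :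
    ⟪x, Matrix.toEuclideanLin (pcaMatrix X Y) y⟫ = ((T : ℝ) * n)⁻¹ *
      ∑ i, ⟪WithLp.toLp 2 (residual X Y i), x⟫ * ⟪WithLp.toLp 2 (residual X Y i), y⟫ := by
  have h1 : ∀ (i : Fin n) (x : EuclideanSpace ℝ (Fin T)), ⟪WithLp.toLp 2 (residual X Y i), x⟫
      = (residual X Y *ᵥ x.ofLp) i := fun i x => inner_toLp _ _
  have h2 : ⟪x, Matrix.toEuclideanLin (pcaMatrix X Y) y⟫ = x.ofLp ⬝ᵥ (pcaMatrix X Y *ᵥ y.ofLp) :=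
    inner_toLp _ _
  simp_rw [h1]
  rw [h2, pcaMatrix, Matrix.smul_mulVec, dotProduct_smul, ← Matrix.mulVec_mulVec,
    Matrix.dotProduct_mulVec, Matrix.vecMul_transpose, smul_eq_mul]
  rfl

lemma toLp_residual {n p r : ℕ} {X : Matrix (Fin T) (Fin p) ℝ} {Y : Matrix (Fin n) (Fin T) ℝ}
    (hu : IsUnit (Xᵀ * X).det) {μ : Fin n → ℝ} {β : Fin n → Fin p → ℝ} {γ : Fin n → Fin r → ℝ}
    {Z : Fin T → Fin r → ℝ} {e : Fin T → Fin n → ℝ}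
    (hY : ∀ i t, Y i t = μ i + β i ⬝ᵥ X t + (∑ k, γ i k * Z t k + e t i)) (i : Fin n) :
    WithLp.toLp 2 (residual X Y i) = unitResidual (proj X) (residualOne X) μ γ
      (fun k => WithLp.toLp 2 fun t => Z t k) (fun i => WithLp.toLp 2 fun t => e t i) i := by
  have hYi : WithLp.toLp 2 (Y i) = μ i • WithLp.toLp 2 (1 : Fin T → ℝ) + WithLp.toLp 2 (X *ᵥ β i)
      + (∑ k, γ i k • WithLp.toLp 2 (fun t => Z t k) + WithLp.toLp 2 fun t => e t i) := by
    ext t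
    simp [hY, Matrix.mulVec, dotProduct_comm (β i)]
  -- Invertibility of the Gram matrix makes the annihilator kill the design, so the regression
  -- coefficients disappear from the residuals.
  have hX : proj X (WithLp.toLp 2 (X *ᵥ β i)) = 0 := by
    rw [proj_toLp, Matrix.mulVec_mulVec, annihilator_mul_design hu, Matrix.zero_mulVec]
    rfl
  rw [residual_apply, ← proj_toLp, hYi, map_add, map_add, hX, add_zero, map_smul]
  rfl

/-- Courant-Fischer with the projected latent paths as test space: `le_norm_proj_comb` gives its
dimension and `le_sum_inner_sq` the lower bound on the Rayleigh quotient. -/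
lemma RegularSample.principalDirections {n p r : ℕ} {X : Matrix (Fin T) (Fin p) ℝ}
    {Y : Matrix (Fin n) (Fin T) ℝ} {μ : Fin n → ℝ} {γ : Fin n → Fin r → ℝ}
    {z : Fin r → EuclideanSpace ℝ (Fin T)} {η : Fin n → EuclideanSpace ℝ (Fin T)}
    {σ : Fin n → Fin n → ℝ} {τ ε g s C : ℝ}
    (h : RegularSample (proj X) (residualOne X) μ γ z η σ T τ ε g s C)
    (hR : ∀ i, WithLp.toLp 2 (residual X Y i) = unitResidual (proj X) (residualOne X) μ γ z η i)
    (hn : 0 < n) {v : Fin r → EuclideanSpace ℝ (Fin T)}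
    (hv : IsLeadingEigenvectors (pcaMatrix X Y) v) :
    PrincipalDirections (proj X) (residualOne X) μ γ z η T (s / 48) v := by
  have hT := h.T_pos
  have hn' : (0 : ℝ) < n := by exact_mod_cast hn
  let W : (Fin r → ℝ) →ₗ[ℝ] EuclideanSpace ℝ (Fin T) :=
    { toFun := fun a => proj X (∑ k, a k • z k)
      map_add' := fun a a' => by simp [add_smul, Finset.sum_add_distrib]
      map_smul' := fun c a => by simp [mul_smul, Finset.smul_sum] }
  have hW : Function.Injective W := by
    rw [← LinearMap.ker_eq_bot, LinearMap.ker_eq_bot']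
    intro a ha
    have h1 := h.le_norm_proj_comb a
    have h2 : proj X (∑ k, a k • z k) = 0 := ha
    rw [h2, norm_zero] at h1
    have h3 : ∑ k, a k ^ 2 ≤ 0 := by
      by_contra! hlt
      have : 0 < (T : ℝ) / 2 * ∑ k, a k ^ 2 := by positivity
      linarith
    have h4 := (Finset.sum_eq_zero_iff_of_nonneg fun k (_ : k ∈ Finset.univ) =>
      sq_nonneg (a k)).1 (le_antisymm h3 (Finset.sum_nonneg fun _ _ => sq_nonneg _))
    ext k
    simpa using h4 k (Finset.mem_univ k)
  obtain ⟨ho, he⟩ := hv.exists_eigenvalue (L := s / 48) W hW (by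
    intro a
    have h1 := h.le_sum_inner_sq a
    rw [inner_pcaMatrix]
    simp_rw [hR, ← sq]
    rw [inv_mul_eq_div, le_div_iff₀ (by positivity)]
    calc _ = s / 48 * (n * T) * ‖proj X (∑ k, a k • z k)‖ ^ 2 := by
          change s / 48 * ‖proj X (∑ k, a k • z k)‖ ^ 2 * (T * n) = _
          ring
      _ ≤ _ := h1)
  refine ⟨by have := h.s_pos; positivity, hn, ho, fun j => ?_⟩
  obtain ⟨l, hl, hlj⟩ := he j
  refine ⟨l, hl, fun x => ?_⟩
  have h1 := inner_pcaMatrix X Y x (v j)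
  rw [hlj, real_inner_smul_right, real_inner_comm] at h1
  simp_rw [hR] at h1
  calc _ = n * T * (l * ⟪v j, x⟫) := by ring
    _ = ∑ i, ⟪unitResidual (proj X) (residualOne X) μ γ z η i, x⟫
        * ⟪unitResidual (proj X) (residualOne X) μ γ z η i, v j⟫ := by
      rw [h1]; field_simp
    _ = _ := Finset.sum_congr rfl fun i _ => mul_comm _ _

end Bridge

/-! ### Tail bounds for quadratic and linear statistics of independent normal variables. -/

section Concentration

/-- Moment generating function of the square of a standard normal variable. -/
lemma integral_exp_mul_sq_gaussianReal {x : ℝ} (hx : x < 1 / 2) :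
    ∫ y, Real.exp (x * y ^ 2) ∂(gaussianReal 0 1) = (√(1 - 2 * x))⁻¹ := by
  rw [integral_gaussianReal_eq_integral_smul one_ne_zero]
  have h1 : ∀ y : ℝ, gaussianPDFReal 0 1 y • Real.exp (x * y ^ 2)
      = (√(2 * Real.pi))⁻¹ * Real.exp (-(1 / 2 - x) * y ^ 2) := by
    intro y
    rw [gaussianPDFReal, smul_eq_mul, mul_assoc, ← Real.exp_add]
    simp only [NNReal.coe_one, mul_one, sub_zero]
    congr 2
    ring
  simp_rw [h1]
  rw [integral_const_mul, integral_gaussian, ← Real.sqrt_inv, ← Real.sqrt_inv,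
    ← Real.sqrt_mul (by positivity)]
  congr 1
  have : (1 / 2 - x) ≠ 0 := by linarith
  have : (1 - 2 * x) ≠ 0 := by linarith
  field_simp

/-- From `-log (1 - y) ≤ (1 - y)⁻¹ - 1` and `(1 + y + 2 y²)(1 - y) = 1 + y² (1 - 2 y) ≥ 1`. After
centring a squared normal variable the linear term cancels and only the quadratic one remains. -/
lemma inv_sqrt_one_sub_le {y : ℝ} (hy : |y| ≤ 1 / 2) :
    (√(1 - y))⁻¹ ≤ Real.exp ((y + 2 * y ^ 2) / 2) := by
  obtain ⟨h1, h2⟩ := abs_le.1 hy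
  have hpos : 0 < 1 - y := by linarith
  have hlog : -Real.log (1 - y) ≤ y + 2 * y ^ 2 := by
    have h3 := Real.log_le_sub_one_of_pos (inv_pos.2 hpos)
    rw [Real.log_inv] at h3
    refine h3.trans ?_
    rw [sub_le_iff_le_add, inv_le_iff_one_le_mul₀ hpos]
    nlinarith [mul_nonneg (sq_nonneg y) (show 0 ≤ 1 - 2 * y by linarith)]
  rw [← Real.exp_log (show 0 < √(1 - y) by positivity), ← Real.exp_neg, Real.log_sqrt hpos.le]
  gcongr
  linarith

variable {Ω : Type*} [MeasurableSpace Ω] {P : Measure Ω} {T : ℕ}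

lemma mgf_sq_sub_le {W : Ω → ℝ} {s : NNReal} (hW : P.map W = gaussianReal 0 s) {x : ℝ}
    (hx : |2 * x * s| ≤ 1 / 2) :
    Integrable (fun ω => Real.exp (x * (W ω ^ 2 - s))) P ∧
      mgf (fun ω => W ω ^ 2 - s) P x ≤ Real.exp (4 * x ^ 2 * s ^ 2) := by
  have hWm : AEMeasurable W P := aemeasurable_of_map_neZero (by rw [hW]; infer_instance)
  have hx' : x * s < 1 / 2 := by have := (abs_le.1 hx).2; linarith
  have hs : gaussianReal 0 s = (gaussianReal 0 1).map (√(s : ℝ) * ·) := by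
    rw [gaussianReal_map_const_mul]
    congr 1
    · simp
    · ext; simp
  have hval : mgf (fun ω => W ω ^ 2 - s) P x
      = Real.exp (-(x * s)) * (√(1 - 2 * (x * s)))⁻¹ := by
    have e1 : mgf (fun ω => W ω ^ 2 - s) P x
        = ∫ y, Real.exp (x * (y ^ 2 - s)) ∂(P.map W) := by
      rw [integral_map hWm (by fun_prop)]; rfl
    rw [e1, hW, hs, integral_map (by fun_prop) (by fun_prop),
      ← integral_exp_mul_sq_gaussianReal hx', ← integral_const_mul]
    congr 1; ext y
    rw [← Real.exp_add, mul_pow, Real.sq_sqrt (NNReal.coe_nonneg s)]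
    congr 1; ring
  have hpos : 0 < √(1 - 2 * (x * s)) := Real.sqrt_pos.2 (by linarith)
  constructor
  -- An integral of a non-integrable function is `0` by convention, whereas the computed value is
  -- positive; hence integrability.
  · refine not_imp_comm.1 integral_undef ?_
    change mgf (fun ω => W ω ^ 2 - s) P x ≠ 0
    rw [hval]
    positivity
  · rw [hval]
    have := inv_sqrt_one_sub_le (y := 2 * (x * s)) (by rwa [← mul_assoc])
    calc _ ≤ Real.exp (-(x * s)) * Real.exp ((2 * (x * s) + 2 * (2 * (x * s)) ^ 2) / 2) := by gcongr
      _ = _ := by rw [← Real.exp_add]; congr 1; ring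

lemma measure_le_ofReal_exp {s : Set Ω} [IsFiniteMeasure P] {x : ℝ} (h : P.real s ≤ x) :
    P s ≤ ENNReal.ofReal x := by
  rw [← ofReal_measureReal]; exact ENNReal.ofReal_le_ofReal h

/-- Concentration of the sum of squares of independent normal variables. -/
lemma measure_sum_sq_sub_le [IsProbabilityMeasure P] {W : Fin T → Ω → ℝ} {s : NNReal}
    (hm : ∀ t, Measurable (W t)) (hind : iIndepFun W P)
    (hW : ∀ t, P.map (W t) = gaussianReal 0 s) (hs : s ≤ 4) {ε : ℝ} (hε : 0 < ε) (hε1 : ε ≤ 1) :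
    P {ω | ε * T < |∑ t, W t ω ^ 2 - T * s|} ≤ ENNReal.ofReal (2 * Real.exp (-(ε ^ 2 * T / 256))) := by
  have hs' : (s : ℝ) ≤ 4 := by exact_mod_cast hs
  have hs0 : (0 : ℝ) ≤ s := s.2
  set V : Fin T → Ω → ℝ := fun t ω => W t ω ^ 2 - s with hV
  have hVm : ∀ t, Measurable (V t) := fun t => ((hm t).pow_const 2).sub_const _
  have hVi : iIndepFun V P :=
    hind.comp (fun _ x => x ^ 2 - (s : ℝ)) fun _ => (measurable_id.pow_const 2).sub_const _
  have hsum : ∀ ω, (∑ t, V t) ω = ∑ t, W t ω ^ 2 - T * s := by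
    intro ω; simp [hV, Finset.sum_sub_distrib]
  -- Chernoff parameter: at `|x| = ε / 128` and `s ≤ 4` the logarithmic moment generating function
  -- is at most `64 x² T = ε² T / 256`, half of the gain `ε² T / 128`.
  have key : ∀ x : ℝ, |x| = ε / 128 → Integrable (fun ω => Real.exp (x * (∑ t, V t) ω)) P ∧
      mgf (∑ t, V t) P x ≤ Real.exp (ε ^ 2 * T / 256) := by
    intro x hx
    have hx1 : |2 * x * s| ≤ 1 / 2 := by
      rw [abs_mul, abs_mul, hx, abs_of_nonneg hs0, abs_two]
      nlinarith
    refine ⟨hVi.integrable_exp_mul_sum hVm fun t _ => (mgf_sq_sub_le (hW t) hx1).1, ?_⟩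
    rw [hVi.mgf_sum hVm]
    calc _ ≤ ∏ _t : Fin T, Real.exp (4 * x ^ 2 * s ^ 2) :=
          Finset.prod_le_prod (fun t _ => mgf_nonneg) fun t _ => (mgf_sq_sub_le (hW t) hx1).2
      _ = Real.exp (T * (4 * x ^ 2 * s ^ 2)) := by
          rw [Finset.prod_const, ← Real.exp_nat_mul]; simp
      _ ≤ _ := by
          gcongr
          have hx2 : x ^ 2 = (ε / 128) ^ 2 := by rw [← sq_abs, hx]
          have hs2 : (s : ℝ) ^ 2 ≤ 16 := by nlinarith
          rw [hx2]
          calc (T : ℝ) * (4 * (ε / 128) ^ 2 * s ^ 2) ≤ T * (4 * (ε / 128) ^ 2 * 16) := by gcongr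
            _ = _ := by ring
  have hp := key (ε / 128) (abs_of_pos (by positivity))
  have hn := key (-(ε / 128)) (by rw [abs_neg, abs_of_pos (by positivity)])
  have h1 := measure_ge_le_exp_mul_mgf (μ := P) (X := ∑ t, V t) (ε * T)
    (show 0 ≤ ε / 128 by positivity) hp.1
  have h2 := measure_le_le_exp_mul_mgf (μ := P) (X := ∑ t, V t) (-(ε * T))
    (show -(ε / 128) ≤ 0 by linarith) hn.1
  have e : Real.exp (-(ε / 128) * (ε * T)) * Real.exp (ε ^ 2 * T / 256)
      = Real.exp (-(ε ^ 2 * T / 256)) := by rw [← Real.exp_add]; congr 1; ring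
  have h1' : P.real {ω | ε * T ≤ (∑ t, V t) ω} ≤ Real.exp (-(ε ^ 2 * T / 256)) := by
    refine h1.trans ?_
    rw [← e]; gcongr; exact hp.2
  have h2' : P.real {ω | (∑ t, V t) ω ≤ -(ε * T)} ≤ Real.exp (-(ε ^ 2 * T / 256)) := by
    refine h2.trans ?_
    rw [← e, neg_neg, show ε / 128 * -(ε * T) = -(ε / 128) * (ε * T) by ring]
    gcongr; exact hn.2
  apply measure_le_ofReal_exp
  calc _ ≤ P.real ({ω | ε * T ≤ (∑ t, V t) ω} ∪ {ω | (∑ t, V t) ω ≤ -(ε * T)}) := by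
        refine measureReal_mono ?_ (measure_ne_top _ _)
        intro ω hω
        simp only [Set.mem_ofPred_eq, Set.mem_union, hsum] at hω ⊢
        rcases lt_abs.1 hω with h | h
        · exact Or.inl h.le
        · exact Or.inr (by linarith)
    _ ≤ _ := (measureReal_union_le _ _).trans (by linarith)

/-- Gaussian tail of a linear combination of independent normal variables. -/
lemma measure_linear_le [IsProbabilityMeasure P] {W : Fin T → Ω → ℝ} {s : NNReal}
    (hind : iIndepFun W P) (hW : ∀ t, P.map (W t) = gaussianReal 0 s) (hs : s ≤ 1)
    (a : Fin T → ℝ) {x : ℝ} (hx : 0 ≤ x) :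
    P {ω | x * √(∑ t, a t ^ 2) < |∑ t, a t * W t ω|}
      ≤ ENNReal.ofReal (2 * Real.exp (-(x ^ 2 / 2))) := by
  have hA : 0 ≤ ∑ t, a t ^ 2 := Finset.sum_nonneg fun _ _ => sq_nonneg _
  rcases hA.eq_or_lt with h0 | hA'
  -- With vanishing coefficients the event reads `0 < 0`; this is why the inequality in it is
  -- strict.
  · have ha : ∀ t, a t = 0 := fun t => by
      simpa using (Finset.sum_eq_zero_iff_of_nonneg fun k (_ : k ∈ Finset.univ) =>
        sq_nonneg (a k)).1 h0.symm t (Finset.mem_univ t)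
    simp [ha]
  have hsub : ∀ b : Fin T → ℝ, (∀ t, b t ^ 2 = a t ^ 2) →
      P.real {ω | x * √(∑ t, a t ^ 2) ≤ ∑ t, b t * W t ω} ≤ Real.exp (-(x ^ 2 / 2)) := by
    intro b hb
    have hi : iIndepFun (fun t ω => b t * W t ω) P :=
      hind.comp (fun t y => b t * y) fun t => measurable_const_mul (b t)
    have hg : ∀ t ∈ Finset.univ, HasSubgaussianMGF (fun ω => b t * W t ω)
        (Real.toNNReal (a t ^ 2)) P := by
      intro t _
      have hWs : HasSubgaussianMGF (W t) 1 P := by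
        refine ⟨fun u => ?_, fun u => ?_⟩
        · refine not_imp_comm.1 integral_undef ?_
          change mgf (W t) P u ≠ 0
          rw [mgf_gaussianReal (hW t)]
          positivity
        · rw [mgf_gaussianReal (hW t)]
          gcongr
          have : (s : ℝ) ≤ 1 := by exact_mod_cast hs
          simp only [NNReal.coe_one]
          nlinarith [sq_nonneg u]
      have := hWs.const_mul (b t)
      convert this using 1
      ext
      rw [Real.coe_toNNReal _ (sq_nonneg _), ← hb t]
      exact (mul_one _).symm
    refine (HasSubgaussianMGF.measure_sum_ge_le_of_iIndepFun hi hg (by positivity)).trans_eq ?_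
    congr 1
    rw [NNReal.coe_sum]
    simp only [Real.coe_toNNReal _ (sq_nonneg _)]
    rw [mul_pow, Real.sq_sqrt hA]
    field_simp
  apply measure_le_ofReal_exp
  calc _ ≤ P.real ({ω | x * √(∑ t, a t ^ 2) ≤ ∑ t, a t * W t ω}
        ∪ {ω | x * √(∑ t, a t ^ 2) ≤ ∑ t, (-a t) * W t ω}) := by
        refine measureReal_mono ?_ (measure_ne_top _ _)
        intro ω hω
        simp only [Set.mem_ofPred_eq, Set.mem_union, neg_mul, Finset.sum_neg_distrib] at hω ⊢
        rcases lt_abs.1 hω with h | h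
        · exact Or.inl h.le
        · exact Or.inr h.le
    _ ≤ _ := (measureReal_union_le _ _).trans (by
        have := hsub a fun _ => rfl
        have := hsub (fun t => -a t) fun _ => neg_sq _
        linarith)

/-- Fubini under the product law: a bound uniform in the frozen value of `U` survives integration
over `U`. This permits weights that depend on the random design and on the latent factors. -/
lemma IndepFun.measure_prodMk_le [IsProbabilityMeasure P] {α β : Type*} [MeasurableSpace α]
    [MeasurableSpace β] {U : Ω → α} {V : Ω → β} (hUV : IndepFun U V P) (hU : Measurable U)
    (hV : Measurable V) {S : Set (α × β)} (hS : MeasurableSet S) {c : ENNReal}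
    (hc : ∀ u, P {ω | (u, V ω) ∈ S} ≤ c) : P {ω | (U ω, V ω) ∈ S} ≤ c := by
  have : IsProbabilityMeasure (P.map U) := Measure.isProbabilityMeasure_map hU.aemeasurable
  have : IsProbabilityMeasure (P.map V) := Measure.isProbabilityMeasure_map hV.aemeasurable
  have h1 : P {ω | (U ω, V ω) ∈ S} = P.map (fun ω => (U ω, V ω)) S :=
    (Measure.map_apply (hU.prodMk hV) hS).symm
  rw [h1, (indepFun_iff_map_prod_eq_prod_map_map hU.aemeasurable hV.aemeasurable).1 hUV,
    Measure.prod_apply hS]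
  calc _ ≤ ∫⁻ _, c ∂(P.map U) := by
        refine lintegral_mono fun u => ?_
        rw [Measure.map_apply hV (measurable_prodMk_left hS)]
        exact hc u
    _ = c := by simp

/-- Gaussian tail of a linear combination whose coefficients are random but independent of the
normal variables. -/
lemma measure_random_linear_le [IsProbabilityMeasure P] {m : ℕ} {α : Type*} [MeasurableSpace α]
    {U : Ω → α} {W : Fin T → Ω → Fin m → ℝ} (hU : Measurable U) (hW : ∀ t, Measurable (W t))
    (hUW : IndepFun U (fun ω t => W t ω) P) (hind : iIndepFun W P) (i : Fin m) {s : NNReal}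
    (hlaw : ∀ t, P.map (fun ω => W t ω i) = gaussianReal 0 s) (hs : s ≤ 1)
    {a : α → Fin T → ℝ} (ha : Measurable a) {x : ℝ} (hx : 0 ≤ x) :
    P {ω | x * √(∑ t, a (U ω) t ^ 2) < |∑ t, a (U ω) t * W t ω i|}
      ≤ ENNReal.ofReal (2 * Real.exp (-(x ^ 2 / 2))) := by
  have hV : Measurable fun ω t => W t ω := measurable_pi_lambda _ hW
  have ha' : ∀ t, Measurable fun q : α × (Fin T → Fin m → ℝ) => a q.1 t := fun t =>
    (measurable_pi_apply t).comp (ha.comp measurable_fst)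
  have hb' : ∀ t, Measurable fun q : α × (Fin T → Fin m → ℝ) => q.2 t i := fun t =>
    (measurable_pi_apply i).comp ((measurable_pi_apply t).comp measurable_snd)
  have hS : MeasurableSet {q : α × (Fin T → Fin m → ℝ) |
      x * √(∑ t, a q.1 t ^ 2) < |∑ t, a q.1 t * q.2 t i|} := by
    apply measurableSet_lt
    · exact ((Finset.measurable_sum _ fun t _ => (ha' t).pow_const 2).sqrt).const_mul x
    · exact measurable_norm.comp (Finset.measurable_sum _ fun t _ => (ha' t).mul (hb' t))
  refine IndepFun.measure_prodMk_le hUW hU hV hS fun u => ?_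
  exact measure_linear_le (W := fun t ω => W t ω i)
    (hind.comp (fun _ y => y i) fun _ => measurable_pi_apply i) hlaw hs (a u) hx

end Concentration

/-! ### Gaussian samples, sample covariances and normality of summands. -/

section GaussianSamples

variable {Ω : Type*} [MeasurableSpace Ω] {P : Measure Ω}

/-- An independent sample from a centred normal distribution with covariance matrix `S`, whose
diagonal entries are at most one. -/
structure IsGaussianSample (P : Measure Ω) {T m : ℕ} (F : Fin T → Ω → Fin m → ℝ)
    (S : Matrix (Fin m) (Fin m) ℝ) : Prop where
  meas : ∀ t, Measurable (F t)
  indep : iIndepFun F P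
  law : ∀ u t, P.map (fun ω => u ⬝ᵥ F t ω) = gaussianReal 0 (u ⬝ᵥ (S *ᵥ u)).toNNReal
  symm : ∀ i j, S i j = S j i
  psd : ∀ u, 0 ≤ u ⬝ᵥ (S *ᵥ u)
  diag_le : ∀ i, S i i ≤ 1

lemma quadForm_single_add {m : ℕ} {S : Matrix (Fin m) (Fin m) ℝ} (hS : ∀ i j, S i j = S j i)
    (u : Fin m → ℝ) (i : Fin m) (c : ℝ) :
    (u + Pi.single i c) ⬝ᵥ (S *ᵥ (u + Pi.single i c))
      = u ⬝ᵥ (S *ᵥ u) + 2 * c * ∑ k, u k * S k i + c ^ 2 * S i i := by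
  have h1 : u ⬝ᵥ (S *ᵥ Pi.single i c) = c * ∑ k, u k * S k i := by
    simp only [Matrix.mulVec_single, dotProduct, Finset.mul_sum, Pi.smul_apply, Matrix.col_apply,
      MulOpposite.smul_eq_mul_unop, MulOpposite.unop_op]
    exact Finset.sum_congr rfl fun k _ => by ring
  have h2 : (S *ᵥ u) i = ∑ k, u k * S k i := by
    simp only [Matrix.mulVec, dotProduct]
    exact Finset.sum_congr rfl fun k _ => by rw [hS i k]; ring
  have h3 : (S *ᵥ Pi.single i c) i = c * S i i := by
    simp [Matrix.mulVec_single]; ring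
  rw [Matrix.mulVec_add, dotProduct_add, add_dotProduct, add_dotProduct, h1, single_dotProduct,
    single_dotProduct, h2, h3]
  ring

lemma quadForm_single {m : ℕ} {S : Matrix (Fin m) (Fin m) ℝ} (hS : ∀ i j, S i j = S j i)
    (i : Fin m) (c : ℝ) : (Pi.single i c : Fin m → ℝ) ⬝ᵥ (S *ᵥ Pi.single i c) = c ^ 2 * S i i := by
  have := quadForm_single_add hS 0 i c
  simpa using this

lemma quadForm_pair {m : ℕ} {S : Matrix (Fin m) (Fin m) ℝ} (hS : ∀ i j, S i j = S j i)
    (k i : Fin m) (c : ℝ) :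
    (Pi.single k 1 + Pi.single i c : Fin m → ℝ) ⬝ᵥ (S *ᵥ (Pi.single k 1 + Pi.single i c))
      = S k k + 2 * c * S k i + c ^ 2 * S i i := by
  rw [quadForm_single_add hS, quadForm_single hS]
  simp [Pi.single_apply]

/-- A row of a covariance matrix with unit bound on the variances has small sum of squares if the
sum of all entries is small. -/
lemma sq_sum_sq_row_le {m : ℕ} {S : Matrix (Fin m) (Fin m) ℝ} (hS : ∀ i j, S i j = S j i)
    (hpsd : ∀ u, 0 ≤ u ⬝ᵥ (S *ᵥ u)) (hd : ∀ i, S i i ≤ 1) (i : Fin m) :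
    (∑ k, S k i ^ 2) ^ 2 ≤ ∑ k, ∑ l, |S k l| := by
  have hle : ∀ k, |S k i| ≤ 1 := by
    intro k
    have h1 := hpsd (Pi.single k 1 + Pi.single i 1)
    have h2 := hpsd (Pi.single k 1 + Pi.single i (-1))
    rw [quadForm_pair hS] at h1 h2
    rw [abs_le]
    constructor <;> nlinarith [hd k, hd i]
  set u : Fin m → ℝ := fun k => S k i with hu
  set c := ∑ k, S k i ^ 2 with hc
  -- Cauchy-Schwarz for the form `S` between the `i`-th row `u` and the `i`-th basis vector: `0 ≤ uᵀ
  -- S u - 2 c² + c² S i i ≤ uᵀ S u - c²`.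
  have h1 := hpsd (u + Pi.single i (-c))
  rw [quadForm_single_add hS] at h1
  have h2 : ∑ k, u k * S k i = c := Finset.sum_congr rfl fun k _ => by rw [sq]
  rw [h2] at h1
  have h3 : u ⬝ᵥ (S *ᵥ u) ≤ ∑ k, ∑ l, |S k l| := by
    simp only [dotProduct, Matrix.mulVec, Finset.mul_sum]
    refine Finset.sum_le_sum fun k _ => Finset.sum_le_sum fun l _ => ?_
    refine (le_abs_self _).trans ?_
    rw [abs_mul, abs_mul]
    have := hle k
    have := hle l
    calc |S k i| * (|S k l| * |S l i|) ≤ 1 * (|S k l| * 1) := by gcongr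
      _ = _ := by ring
  nlinarith [hd i, sq_nonneg c]

lemma measurable_dotProduct {m : ℕ} (u : Fin m → ℝ) : Measurable fun y : Fin m → ℝ => u ⬝ᵥ y := by
  simp only [dotProduct]; fun_prop

namespace IsGaussianSample

variable {T m : ℕ} {F : Fin T → Ω → Fin m → ℝ} {S : Matrix (Fin m) (Fin m) ℝ}
  [IsProbabilityMeasure P] (h : IsGaussianSample P F S)
include h

lemma measure_quadForm_le (u : Fin m → ℝ) (hu : u ⬝ᵥ (S *ᵥ u) ≤ 4) {ε : ℝ} (hε : 0 < ε)
    (hε1 : ε ≤ 1) :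
    P {ω | ε * T < |∑ t, (u ⬝ᵥ F t ω) ^ 2 - T * (u ⬝ᵥ (S *ᵥ u))|}
      ≤ ENNReal.ofReal (2 * Real.exp (-(ε ^ 2 * T / 256))) := by
  have := measure_sum_sq_sub_le (P := P) (W := fun t ω => u ⬝ᵥ F t ω)
    (s := (u ⬝ᵥ (S *ᵥ u)).toNNReal)
    (fun t => (measurable_dotProduct u).comp (h.meas t))
    (h.indep.comp (fun _ y => u ⬝ᵥ y) fun _ => measurable_dotProduct u) (h.law u)
    (by rw [Real.toNNReal_le_iff_le_coe]; exact_mod_cast hu) hε hε1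
  rwa [Real.coe_toNNReal _ (h.psd u)] at this

/-- Concentration of the sample covariances. -/
lemma measure_sum_mul_sub_le (k i : Fin m) {ε : ℝ} (hε : 0 < ε) (hε1 : ε ≤ 1) :
    P {ω | ε * T < |∑ t, F t ω k * F t ω i - T * S k i|}
      ≤ ENNReal.ofReal (4 * Real.exp (-(ε ^ 2 * T / 256))) := by
  -- Polarization reduces products to squares of sums and differences. By the parallelogram identity
  -- their variances are at most `2 (S k k + S i i) ≤ 4`, which is where the bound `4` in
  -- `measure_sum_sq_sub_le` comes from.
  have hle : ∀ c : ℝ, c ^ 2 = 1 →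
      (Pi.single k 1 + Pi.single i c : Fin m → ℝ) ⬝ᵥ (S *ᵥ (Pi.single k 1 + Pi.single i c)) ≤ 4 := by
    intro c hc
    have h1 := h.psd (Pi.single k 1 + Pi.single i (-c))
    rw [quadForm_pair h.symm] at h1 ⊢
    rw [neg_sq, hc] at h1
    rw [hc]
    linarith [h.diag_le k, h.diag_le i]
  have h1 := h.measure_quadForm_le _ (hle 1 (by norm_num)) hε hε1
  have h2 := h.measure_quadForm_le _ (hle (-1) (by norm_num)) hε hε1
  have hsub : {ω | ε * T < |∑ t, F t ω k * F t ω i - T * S k i|} ⊆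
      {ω | ε * T < |∑ t, ((Pi.single k 1 + Pi.single i 1 : Fin m → ℝ) ⬝ᵥ F t ω) ^ 2 -
        T * ((Pi.single k 1 + Pi.single i 1 : Fin m → ℝ) ⬝ᵥ
          (S *ᵥ (Pi.single k 1 + Pi.single i 1)))|} ∪
      {ω | ε * T < |∑ t, ((Pi.single k 1 + Pi.single i (-1) : Fin m → ℝ) ⬝ᵥ F t ω) ^ 2 -
        T * ((Pi.single k 1 + Pi.single i (-1) : Fin m → ℝ) ⬝ᵥ
          (S *ᵥ (Pi.single k 1 + Pi.single i (-1))))|} := by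
    intro ω hω
    by_contra hcon
    simp only [Set.mem_union, Set.mem_ofPred_eq, not_or, not_lt] at hcon hω
    rw [quadForm_pair h.symm, quadForm_pair h.symm] at hcon
    simp only [add_dotProduct, single_dotProduct, one_mul, neg_one_mul] at hcon
    obtain ⟨c1, c2⟩ := hcon
    have e : ∑ t, F t ω k * F t ω i - T * S k i
        = ((∑ t, (F t ω k + F t ω i) ^ 2 - T * (S k k + 2 * 1 * S k i + 1 ^ 2 * S i i))
          - (∑ t, (F t ω k + -F t ω i) ^ 2 - T * (S k k + 2 * (-1) * S k i + (-1) ^ 2 * S i i))) / 4 := by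
      have : ∑ t, F t ω k * F t ω i
          = (∑ t, (F t ω k + F t ω i) ^ 2 - ∑ t, (F t ω k + -F t ω i) ^ 2) / 4 := by
        rw [← Finset.sum_sub_distrib, Finset.sum_div]
        exact Finset.sum_congr rfl fun t _ => by ring
      rw [this]; ring
    rw [e, abs_div, abs_of_pos (by norm_num : (0 : ℝ) < 4), lt_div_iff₀ (by norm_num)] at hω
    have := abs_sub (∑ t, (F t ω k + F t ω i) ^ 2 - T * (S k k + 2 * 1 * S k i + 1 ^ 2 * S i i))
      (∑ t, (F t ω k + -F t ω i) ^ 2 - T * (S k k + 2 * (-1) * S k i + (-1) ^ 2 * S i i))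
    have : 0 ≤ ε * T := by positivity
    linarith
  refine (measure_mono hsub).trans ((measure_union_le _ _).trans ((add_le_add h1 h2).trans_eq ?_))
  rw [← ENNReal.ofReal_add (by positivity) (by positivity)]
  congr 1; ring

lemma measure_linear_le {α : Type*} [MeasurableSpace α] {U : Ω → α} (hU : Measurable U)
    (hUF : IndepFun U (fun ω t => F t ω) P) (i : Fin m) {a : α → Fin T → ℝ} (ha : Measurable a)
    {x : ℝ} (hx : 0 ≤ x) :
    P {ω | x * √(∑ t, a (U ω) t ^ 2) < |∑ t, a (U ω) t * F t ω i|}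
      ≤ ENNReal.ofReal (2 * Real.exp (-(x ^ 2 / 2))) := by
  refine measure_random_linear_le hU h.meas hUF h.indep i (s := (S i i).toNNReal) (fun t => ?_)
    (by rw [Real.toNNReal_le_iff_le_coe]; exact_mod_cast h.diag_le i) ha hx
  have := h.law (Pi.single i 1) t
  rw [quadForm_single h.symm] at this
  simpa using this

end IsGaussianSample

lemma variance_dotProduct [IsProbabilityMeasure P] {m : ℕ} {F : Ω → Fin m → ℝ}
    {S : Matrix (Fin m) (Fin m) ℝ} (hF : ∀ i, MemLp (fun ω => F ω i) 2 P)
    (hS : ∀ i j, cov[fun ω => F ω i, fun ω => F ω j; P] = S i j) (u : Fin m → ℝ) :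
    Var[fun ω => u ⬝ᵥ F ω; P] = u ⬝ᵥ (S *ᵥ u) := by
  have hm : ∀ i, MemLp (fun ω => u i * F ω i) 2 P := fun i => (hF i).const_mul (u i)
  have hae : AEMeasurable (fun ω => u ⬝ᵥ F ω) P :=
    (memLp_finsetSum Finset.univ fun i _ => hm i).aestronglyMeasurable.aemeasurable
  rw [← covariance_self hae]
  change cov[fun ω => ∑ i, u i * F ω i, fun ω => ∑ i, u i * F ω i; P] = _
  rw [covariance_fun_sum_fun_sum hm hm]
  simp only [dotProduct, Matrix.mulVec, Finset.mul_sum]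
  refine Finset.sum_congr rfl fun i _ => Finset.sum_congr rfl fun j _ => ?_
  rw [covariance_const_mul_left, covariance_const_mul_right, hS]
  ring

lemma integral_dotProduct {m : ℕ} {F : Ω → Fin m → ℝ} (hF : ∀ i, Integrable (fun ω => F ω i) P)
    (h0 : ∀ i, ∫ ω, F ω i ∂P = 0) (u : Fin m → ℝ) : ∫ ω, u ⬝ᵥ F ω ∂P = 0 := by
  change ∫ ω, ∑ i, u i * F ω i ∂P = 0
  rw [integral_finsetSum _ fun i _ => (hF i).const_mul (u i)]
  simp_rw [integral_const_mul, h0, mul_zero, Finset.sum_const_zero]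

lemma HasGaussianLaw.dotProduct {m : ℕ} {F : Ω → Fin m → ℝ} (hF : HasGaussianLaw F P)
    (u : Fin m → ℝ) : HasGaussianLaw (fun ω => u ⬝ᵥ F ω) P := by
  have := hF.map_fun (∑ i, u i • (ContinuousLinearMap.proj i : (Fin m → ℝ) →L[ℝ] ℝ))
  simpa [_root_.dotProduct] using this

/-- A summand of a normal variable is normal if it is independent of the other summand and that
one is normal. -/
lemma map_eq_gaussianReal_of_add [IsProbabilityMeasure P] {A B : Ω → ℝ} (hA : MemLp A 2 P)
    (hAB : IndepFun A B P) (hB : HasGaussianLaw B P) (hs : HasGaussianLaw (fun ω => A ω + B ω) P)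
    (hB0 : ∫ ω, B ω ∂P = 0) (hs0 : ∫ ω, (A ω + B ω) ∂P = 0) :
    P.map A = gaussianReal 0 Var[A; P].toNNReal := by
  have hAm := hA.aestronglyMeasurable.aemeasurable
  have hvar : Var[fun ω => A ω + B ω; P] = Var[A; P] + Var[B; P] :=
    hAB.variance_add hA hB.memLp_two
  have h1 := hAB.charFun_map_fun_add_eq_mul hAm hB.aemeasurable
  rw [hs.map_eq_gaussianReal, hB.map_eq_gaussianReal, hB0, hs0, hvar] at h1
  have : IsProbabilityMeasure (P.map A) := Measure.isProbabilityMeasure_map hAm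
  apply Measure.ext_of_charFun
  ext x
  have h2 := congrFun h1 x
  rw [Pi.mul_apply, charFun_gaussianReal, charFun_gaussianReal,
    Real.coe_toNNReal _ (add_nonneg (variance_nonneg _ _) (variance_nonneg _ _)),
    Real.coe_toNNReal _ (variance_nonneg _ _)] at h2
  rw [charFun_gaussianReal, Real.coe_toNNReal _ (variance_nonneg _ _)]
  -- The characteristic function of the normal summand never vanishes, so it can be divided out.
  refine mul_right_cancel₀ (Complex.exp_ne_zero _) (h2.symm.trans ?_)
  rw [← Complex.exp_add]
  congr 1
  push_cast
  ring

end GaussianSamples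

/-! ### Normality and variance bounds in the factor model. -/

namespace Panel

variable {p r : ℕ} {Ω : ℕ → Type*} [∀ T, MeasurableSpace (Ω T)] {D : Panel p r Ω}

namespace IsGaussianFactorModel

variable (hmodel : D.IsGaussianFactorModel) {T : ℕ}
include hmodel

lemma memLp_noise (t : Fin T) (i : Fin (D.N T)) : MemLp (fun ω => D.noise T t ω i) 2 (D.P T) :=
  (by simpa using HasGaussianLaw.dotProduct (hmodel.gaussian_noise T t) (Pi.single i 1) :
    HasGaussianLaw (fun ω => D.noise T t ω i) (D.P T)).memLp_two

lemma memLp_err (t : Fin T) (i : Fin (D.N T)) : MemLp (fun ω => D.err T t ω i) 2 (D.P T) :=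
  (by simpa using HasGaussianLaw.dotProduct (hmodel.gaussian_err T t) (Pi.single i 1) :
    HasGaussianLaw (fun ω => D.err T t ω i) (D.P T)).memLp_two

lemma variance_noise (u : Fin (D.N T) → ℝ) (t : Fin T) :
    Var[fun ω => u ⬝ᵥ D.noise T t ω; D.P T] = u ⬝ᵥ (D.Sigma T *ᵥ u) := by
  have := hmodel.prob T
  exact variance_dotProduct (hmodel.memLp_noise t) (hmodel.cov_noise T t) u

lemma indep_Z_noise_at (t : Fin T) : IndepFun (D.Z T t) (D.noise T t) (D.P T) :=
  (hmodel.indep_Z_noise T).comp (φ := fun z : Fin T → Fin r → ℝ => z t)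
    (ψ := fun z : Fin T → Fin (D.N T) → ℝ => z t)
    (measurable_pi_apply t) (measurable_pi_apply t)

/-- The unit variance of the response splits over the independent regressor, factor and noise parts,
and each part is nonnegative. -/
lemma Sigma_diag_le (hT : 0 < T) (i : Fin (D.N T)) : D.Sigma T i i ≤ 1 := by
  have := hmodel.prob T
  let t : Fin T := ⟨0, hT⟩
  have hnoise := hmodel.memLp_noise t i
  have herr := hmodel.memLp_err t i
  have hZ : MemLp (fun ω => D.gamma T i ⬝ᵥ D.Z T t ω) 2 (D.P T) :=
    memLp_finsetSum Finset.univ fun k _ => (hmodel.memLp_Z T t k).const_mul (D.gamma T i k)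
  -- The regressors themselves are only integrable; square integrability of this combination comes
  -- from the response and the error.
  have hX : MemLp (fun ω => D.mu T i + D.beta T i ⬝ᵥ D.X T t ω) 2 (D.P T) := by
    have : (fun ω => D.mu T i + D.beta T i ⬝ᵥ D.X T t ω)
        = fun ω => D.response T i t ω - D.err T t ω i := by
      ext ω; simp [response]
    rw [this]
    exact (hmodel.memLp_Y T i t).sub herr
  have hind1 : IndepFun (fun ω => D.mu T i + D.beta T i ⬝ᵥ D.X T t ω)
      (fun ω => D.err T t ω i) (D.P T) := by
    have := (hmodel.indep_X T).comp
      (φ := fun x => D.mu T i + D.beta T i ⬝ᵥ x t)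
      (ψ := fun y => (D.gamma T *ᵥ (y t).1 + (y t).2) i)
      (by simp only [dotProduct]; fun_prop)
      (by simp only [Pi.add_apply, Matrix.mulVec, dotProduct]; fun_prop)
    exact this
  have hind2 : IndepFun (fun ω => D.gamma T i ⬝ᵥ D.Z T t ω)
      (fun ω => D.noise T t ω i) (D.P T) :=
    (hmodel.indep_Z_noise_at t).comp (φ := fun z => D.gamma T i ⬝ᵥ z)
      (ψ := fun e : Fin (D.N T) → ℝ => e i) (measurable_dotProduct _) (measurable_pi_apply i)
  have h1 : Var[fun ω => D.mu T i + D.beta T i ⬝ᵥ D.X T t ω + D.err T t ω i; D.P T] = _ :=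
    hind1.variance_add hX herr
  have h2 : Var[fun ω => D.gamma T i ⬝ᵥ D.Z T t ω + D.noise T t ω i; D.P T] = _ :=
    hind2.variance_add hZ hnoise
  have h3 : Var[fun ω => D.mu T i + D.beta T i ⬝ᵥ D.X T t ω + D.err T t ω i; D.P T] = 1 :=
    hmodel.var_Y T i t
  have h4 : Var[fun ω => D.noise T t ω i; D.P T] = D.Sigma T i i := by
    rw [← covariance_self hnoise.aestronglyMeasurable.aemeasurable, hmodel.cov_noise T t]
  have h5 : Var[fun ω => D.err T t ω i; D.P T]
      = Var[fun ω => D.gamma T i ⬝ᵥ D.Z T t ω + D.noise T t ω i; D.P T] := rfl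
  have := variance_nonneg (fun ω => D.mu T i + D.beta T i ⬝ᵥ D.X T t ω) (D.P T)
  have := variance_nonneg (fun ω => D.gamma T i ⬝ᵥ D.Z T t ω) (D.P T)
  linarith

lemma isGaussianSample_noise (hT : 0 < T) :
    IsGaussianSample (D.P T) (D.noise T) (D.Sigma T) where
  meas := hmodel.meas_noise T
  indep := hmodel.indep_noise T
  law u t := by
    have := hmodel.prob T
    rw [(HasGaussianLaw.dotProduct (hmodel.gaussian_noise T t) u).map_eq_gaussianReal,
      hmodel.variance_noise, integral_dotProduct
        (fun i => (hmodel.memLp_noise t i).integrable one_le_two) (hmodel.mean_noise T t)]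
  symm i j := by
    rw [← hmodel.cov_noise T ⟨0, hT⟩ i j, covariance_comm, hmodel.cov_noise]
  psd u := by
    rw [← hmodel.variance_noise u ⟨0, hT⟩]
    exact variance_nonneg _ _
  diag_le := hmodel.Sigma_diag_le hT

/-- The latent factors are normal if the loading matrix is injective. -/
lemma isGaussianSample_Z (hγ : ∀ a : Fin r → ℝ, ∃ u : Fin (D.N T) → ℝ, (D.gamma T)ᵀ *ᵥ u = a) :
    IsGaussianSample (D.P T) (D.Z T) 1 where
  meas := hmodel.meas_Z T
  indep := hmodel.indep_Z T
  law a t := by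
    have := hmodel.prob T
    -- With `γᵀ u = a`, adding the independent normal variable `uᵀ η` to `aᵀ Z` gives the normal
    -- variable `uᵀ E`.
    obtain ⟨u, hu⟩ := hγ a
    have hA : MemLp (fun ω => a ⬝ᵥ D.Z T t ω) 2 (D.P T) :=
      memLp_finsetSum Finset.univ fun k _ => (hmodel.memLp_Z T t k).const_mul (a k)
    have hvar : Var[fun ω => a ⬝ᵥ D.Z T t ω; D.P T]
        = a ⬝ᵥ ((1 : Matrix (Fin r) (Fin r) ℝ) *ᵥ a) :=
      variance_dotProduct (hmodel.memLp_Z T t)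
        (fun i j => by rw [hmodel.cov_Z, Matrix.one_apply]) a
    have hsum : (fun ω => a ⬝ᵥ D.Z T t ω + u ⬝ᵥ D.noise T t ω) = fun ω => u ⬝ᵥ D.err T t ω := by
      ext ω
      rw [err, dotProduct_add, Matrix.dotProduct_mulVec, ← Matrix.mulVec_transpose, hu]
    rw [← hvar]
    refine map_eq_gaussianReal_of_add (B := fun ω => u ⬝ᵥ D.noise T t ω) hA ?_
      (HasGaussianLaw.dotProduct (hmodel.gaussian_noise T t) u) ?_ ?_ ?_
    · exact (hmodel.indep_Z_noise_at t).comp (φ := fun z => a ⬝ᵥ z) (ψ := fun e => u ⬝ᵥ e)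
        (measurable_dotProduct a) (measurable_dotProduct u)
    · rw [hsum]
      exact HasGaussianLaw.dotProduct (hmodel.gaussian_err T t) u
    · exact integral_dotProduct (fun i => (hmodel.memLp_noise t i).integrable one_le_two)
        (hmodel.mean_noise T t) u
    · rw [hsum]
      exact integral_dotProduct (fun i => (hmodel.memLp_err t i).integrable one_le_two)
        (hmodel.mean_err T t) u
  symm i j := by simp [Matrix.one_apply, eq_comm]
  psd u := by
    rw [Matrix.one_mulVec]
    exact Finset.sum_nonneg fun i _ => mul_self_nonneg _
  diag_le i := by simp

end IsGaussianFactorModel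

end Panel

/-! ### The probability of a typical sample, and its regularity. -/

section GoodEvent

/-- The adjugate and determinant are continuous in the design, and real inversion is measurable also
at `0`, so singular designs cause no difficulty. -/
lemma measurable_annihilator_apply {T p : ℕ} (s t : Fin T) :
    Measurable fun x : Fin T → Fin p → ℝ => annihilator (Matrix.of x) s t := by
  have hof : Continuous fun x : Fin T → Fin p → ℝ => (Matrix.of x : Matrix (Fin T) (Fin p) ℝ) :=
    continuous_id
  have hc : Continuous fun x : Fin T → Fin p → ℝ => (Matrix.of x)ᵀ * Matrix.of x :=
    hof.matrix_transpose.matrix_mul hof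
  have hinv : ∀ j k, Measurable fun x : Fin T → Fin p → ℝ =>
      ((Matrix.of x)ᵀ * Matrix.of x)⁻¹ j k := by
    intro j k
    simp only [Matrix.inv_def, Ring.inverse_eq_inv', Matrix.smul_apply, smul_eq_mul]
    exact hc.matrix_det.measurable.inv.mul (hc.matrix_adjugate.matrix_elem j k).measurable
  have hx : ∀ (s : Fin T) (j : Fin p), Measurable fun x : Fin T → Fin p → ℝ => x s j :=
    fun s j => (hof.matrix_elem s j).measurable
  simp only [annihilator, Matrix.sub_apply, Matrix.mul_apply, Matrix.transpose_apply,
    Matrix.of_apply]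
  exact measurable_const.sub (Finset.measurable_sum _ fun j _ =>
    (Finset.measurable_sum _ fun k _ => (hx s k).mul (by simpa [Matrix.mul_apply] using hinv k j)).mul (hx t j))

variable {Ω : Type*} [MeasurableSpace Ω] {P : Measure Ω}

lemma measure_exists_le {ι : Type*} [Fintype ι] {q : ι → Ω → Prop} {c : ℝ}
    (h : ∀ i, P {ω | q i ω} ≤ ENNReal.ofReal c) :
    P {ω | ∃ i, q i ω} ≤ ENNReal.ofReal (Fintype.card ι * c) := by
  have : {ω | ∃ i, q i ω} = ⋃ i, {ω | q i ω} := by ext; simp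
  rw [this]
  refine (measure_iUnion_fintype_le _ _).trans ((Finset.sum_le_sum fun i _ => h i).trans_eq ?_)
  rw [Finset.sum_const, Finset.card_univ, nsmul_eq_mul, ENNReal.ofReal_mul (by positivity),
    ENNReal.ofReal_natCast]

/-- The joint law is a triple product, which can be reassociated. It makes the noise independent of
the design and the latent factors jointly, as needed for the weights `Q z_k`. -/
lemma IndepFun.prodMk_left_of_right [IsProbabilityMeasure P] {α β γ : Type*} [MeasurableSpace α]
    [MeasurableSpace β] [MeasurableSpace γ] {U : Ω → α} {V : Ω → β} {W : Ω → γ}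
    (hU : Measurable U) (hV : Measurable V) (hW : Measurable W)
    (h : IndepFun U (fun ω => (V ω, W ω)) P) (hVW : IndepFun V W P) :
    IndepFun (fun ω => (U ω, V ω)) W P := by
  have : IsProbabilityMeasure (P.map U) := Measure.isProbabilityMeasure_map hU.aemeasurable
  have : IsProbabilityMeasure (P.map V) := Measure.isProbabilityMeasure_map hV.aemeasurable
  have : IsProbabilityMeasure (P.map W) := Measure.isProbabilityMeasure_map hW.aemeasurable
  have hUV : IndepFun U V P := h.comp (φ := id) (ψ := Prod.fst) measurable_id measurable_fst
  rw [indepFun_iff_map_prod_eq_prod_map_map (hU.prodMk hV).aemeasurable hW.aemeasurable,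
    (indepFun_iff_map_prod_eq_prod_map_map hU.aemeasurable hV.aemeasurable).1 hUV]
  have h1 := (indepFun_iff_map_prod_eq_prod_map_map hU.aemeasurable
    (hV.prodMk hW).aemeasurable).1 h
  rw [(indepFun_iff_map_prod_eq_prod_map_map hV.aemeasurable hW.aemeasurable).1 hVW] at h1
  have h2 := congrArg (Measure.map (MeasurableEquiv.prodAssoc (α := α) (β := β) (γ := γ)).symm) h1
  rw [← Measure.prodAssoc_prod, Measure.map_map (MeasurableEquiv.measurable _)
    (MeasurableEquiv.measurable _), Measure.map_map (MeasurableEquiv.measurable _)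
    (hU.prodMk (hV.prodMk hW))] at h2
  rw [MeasurableEquiv.symm_comp_self, Measure.map_id] at h2
  exact h2

lemma measure_union_le_ofReal {s t : Set Ω} {a b : ℝ} (ha : 0 ≤ a) (hb : 0 ≤ b)
    (hs : P s ≤ ENNReal.ofReal a) (ht : P t ≤ ENNReal.ofReal b) :
    P (s ∪ t) ≤ ENNReal.ofReal (a + b) := by
  rw [ENNReal.ofReal_add ha hb]
  exact (measure_union_le _ _).trans (add_le_add hs ht)

end GoodEvent

namespace Panel

variable {p r : ℕ} {Ω : ℕ → Type*} [∀ T, MeasurableSpace (Ω T)] {D : Panel p r Ω}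

/-- The observed path of a latent factor. -/
def latent (D : Panel p r Ω) (T : ℕ) (ω : Ω T) (k : Fin r) : EuclideanSpace ℝ (Fin T) :=
  WithLp.toLp 2 fun t => D.Z T t ω k

/-- The path of the idiosyncratic error of a unit. -/
def unitNoise (D : Panel p r Ω) (T : ℕ) (ω : Ω T) (i : Fin (D.N T)) : EuclideanSpace ℝ (Fin T) :=
  WithLp.toLp 2 fun t => D.noise T t ω i

/-- The event that the sample second moments are close to the population ones, and that the
standardized linear statistics entering the test statistics are bounded by `τ`. -/
structure IsTypical (D : Panel p r Ω) (T : ℕ) (τ ε : ℝ) (ω : Ω T) : Prop where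
  noise_noise : ∀ q : Fin (D.N T) × Fin (D.N T),
    |∑ t, D.noise T t ω q.1 * D.noise T t ω q.2 - T * D.Sigma T q.1 q.2| ≤ ε * T
  latent_latent : ∀ q : Fin r × Fin r, |∑ t, D.Z T t ω q.1 * D.Z T t ω q.2
    - T * (1 : Matrix (Fin r) (Fin r) ℝ) q.1 q.2| ≤ ε * T
  one_noise : ∀ i, |∑ t, (annihilator (D.designMatrix T ω) *ᵥ 1) t * D.noise T t ω i|
    ≤ τ * √(∑ t, (annihilator (D.designMatrix T ω) *ᵥ 1) t ^ 2)
  design_noise : ∀ q : Fin T × Fin (D.N T),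
    |∑ t, (1 - annihilator (D.designMatrix T ω)) q.1 t * D.noise T t ω q.2|
      ≤ τ * √(∑ t, (1 - annihilator (D.designMatrix T ω)) q.1 t ^ 2)
  latent_noise : ∀ q : Fin r × Fin (D.N T),
    |∑ t, (annihilator (D.designMatrix T ω) *ᵥ fun s => D.Z T s ω q.1) t * D.noise T t ω q.2|
      ≤ τ * √(∑ t, (annihilator (D.designMatrix T ω) *ᵥ fun s => D.Z T s ω q.1) t ^ 2)
  one_latent : ∀ k, |∑ t, (annihilator (D.designMatrix T ω) *ᵥ 1) t * D.Z T t ω k|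
    ≤ τ * √(∑ t, (annihilator (D.designMatrix T ω) *ᵥ 1) t ^ 2)
  design_latent : ∀ q : Fin T × Fin r,
    |∑ t, (1 - annihilator (D.designMatrix T ω)) q.1 t * D.Z T t ω q.2|
      ≤ τ * √(∑ t, (1 - annihilator (D.designMatrix T ω)) q.1 t ^ 2)

/-- Union bound: the first term counts the sample covariances, the second the linear statistics,
whose weights are frozen by independence before the Gaussian tail is applied. -/
lemma IsGaussianFactorModel.measure_not_isTypical_le (hmodel : D.IsGaussianFactorModel) {T : ℕ}
    (hT : 0 < T) (hZ : IsGaussianSample (D.P T) (D.Z T) 1) {τ ε : ℝ} (hτ : 0 ≤ τ) (hε : 0 < ε)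
    (hε1 : ε ≤ 1) :
    D.P T {ω | ¬ D.IsTypical T τ ε ω} ≤ ENNReal.ofReal
      (((D.N T : ℝ) ^ 2 + r ^ 2) * (4 * Real.exp (-(ε ^ 2 * T / 256)))
        + (D.N T + r) * (1 + T + r) * (2 * Real.exp (-(τ ^ 2 / 2)))) := by
  have := hmodel.prob T
  have hη := hmodel.isGaussianSample_noise hT
  have mX : Measurable fun ω t => D.X T t ω := measurable_pi_lambda _ (hmodel.meas_X T)
  have mZ : Measurable fun ω t => D.Z T t ω := measurable_pi_lambda _ (hmodel.meas_Z T)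
  have mη : Measurable fun ω t => D.noise T t ω := measurable_pi_lambda _ (hmodel.meas_noise T)
  have iXZη : IndepFun (fun ω t => D.X T t ω)
      (fun ω => ((fun t => D.Z T t ω), fun t => D.noise T t ω)) (D.P T) :=
    (hmodel.indep_X T).comp (φ := id)
      (ψ := fun y : Fin T → (Fin r → ℝ) × (Fin (D.N T) → ℝ) => (fun t => (y t).1, fun t => (y t).2))
      measurable_id (by fun_prop)
  have iXZ : IndepFun (fun ω t => D.X T t ω) (fun ω t => D.Z T t ω) (D.P T) :=
    iXZη.comp measurable_id measurable_fst
  have iXη : IndepFun (fun ω t => D.X T t ω) (fun ω t => D.noise T t ω) (D.P T) :=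
    iXZη.comp measurable_id measurable_snd
  have iη : IndepFun (fun ω => ((fun t => D.X T t ω), fun t => D.Z T t ω))
      (fun ω t => D.noise T t ω) (D.P T) :=
    IndepFun.prodMk_left_of_right mX mZ mη iXZη (hmodel.indep_Z_noise T)
  have m1 : Measurable fun x : Fin T → Fin p → ℝ => annihilator (Matrix.of x) *ᵥ 1 := by
    refine measurable_pi_lambda _ fun t => ?_
    simp only [Matrix.mulVec, dotProduct]
    exact Finset.measurable_sum _ fun s _ => (measurable_annihilator_apply t s).mul_const _
  have m2 : ∀ s, Measurable fun x : Fin T → Fin p → ℝ => (1 - annihilator (Matrix.of x)) s :=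
    fun s => measurable_pi_lambda _ fun t => (measurable_annihilator_apply s t).const_sub _
  have m3 : ∀ k, Measurable fun x : (Fin T → Fin p → ℝ) × (Fin T → Fin r → ℝ) =>
      annihilator (Matrix.of x.1) *ᵥ fun s => x.2 s k := by
    refine fun k => measurable_pi_lambda _ fun t => ?_
    simp only [Matrix.mulVec, dotProduct]
    exact Finset.measurable_sum _ fun s _ =>
      ((measurable_annihilator_apply t s).comp measurable_fst).mul (by fun_prop)
  set c₁ := 4 * Real.exp (-(ε ^ 2 * T / 256))
  set c₂ := 2 * Real.exp (-(τ ^ 2 / 2))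
  have h₁ : 0 ≤ c₁ := by positivity
  have h₂ : 0 ≤ c₂ := by positivity
  have e1 := measure_exists_le
    fun q : Fin (D.N T) × Fin (D.N T) => hη.measure_sum_mul_sub_le q.1 q.2 hε hε1
  have e2 := measure_exists_le
    fun q : Fin r × Fin r => hZ.measure_sum_mul_sub_le q.1 q.2 hε hε1
  have e3 := measure_exists_le fun i => hη.measure_linear_le mX iXη i m1 hτ
  have e4 := measure_exists_le
    fun q : Fin T × Fin (D.N T) => hη.measure_linear_le mX iXη q.2 (m2 q.1) hτ
  have e5 := measure_exists_le
    fun q : Fin r × Fin (D.N T) => hη.measure_linear_le (mX.prodMk mZ) iη q.2 (m3 q.1) hτ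
  have e6 := measure_exists_le fun k => hZ.measure_linear_le mX iXZ k m1 hτ
  have e7 := measure_exists_le
    fun q : Fin T × Fin r => hZ.measure_linear_le mX iXZ q.2 (m2 q.1) hτ
  have hp : ∀ (k : ℕ) {c : ℝ}, 0 ≤ c → 0 ≤ (k : ℝ) * c := fun k c hc => by positivity
  have hU := measure_union_le_ofReal (hp _ h₁) (by positivity) e1 <|
    measure_union_le_ofReal (hp _ h₁) (by positivity) e2 <|
    measure_union_le_ofReal (hp _ h₂) (by positivity) e3 <|
    measure_union_le_ofReal (hp _ h₂) (by positivity) e4 <|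
    measure_union_le_ofReal (hp _ h₂) (by positivity) e5 <|
    measure_union_le_ofReal (hp _ h₂) (hp _ h₂) e6 e7
  refine (measure_mono ?_).trans (hU.trans (ENNReal.ofReal_le_ofReal ?_))
  · intro ω hω
    by_contra hcon
    simp only [Set.mem_union, not_or] at hcon
    obtain ⟨n1, n2, n3, n4, n5, n6, n7⟩ := hcon
    exact hω ⟨fun q => not_lt.1 fun hlt => n1 ⟨q, hlt⟩, fun q => not_lt.1 fun hlt => n2 ⟨q, hlt⟩,
      fun q => not_lt.1 fun hlt => n3 ⟨q, hlt⟩, fun q => not_lt.1 fun hlt => n4 ⟨q, hlt⟩,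
      fun q => not_lt.1 fun hlt => n5 ⟨q, hlt⟩, fun q => not_lt.1 fun hlt => n6 ⟨q, hlt⟩,
      fun q => not_lt.1 fun hlt => n7 ⟨q, hlt⟩⟩
  · simp only [Fintype.card_prod, Fintype.card_fin, Nat.cast_mul]
    have : 0 ≤ (r : ℝ) ^ 2 * c₂ := by positivity
    nlinarith

/-- A typical sample with an invertible design is regular. -/
lemma IsTypical.regularSample {T : ℕ} {τ ε g s C : ℝ} {ω : Ω T} (h : D.IsTypical T τ ε ω)
    (hu : IsUnit ((D.designMatrix T ω)ᵀ * D.designMatrix T ω).det) (hT : 0 < T)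
    (hτ1 : 1 ≤ τ) (hτ : τ ^ 2 ≤ ε ^ 2 * T) (hpτ : p * τ ^ 2 ≤ ε * T) (hε : 0 < ε) (hε1 : ε ≤ 1)
    (hd : ∀ i, D.Sigma T i i ≤ 1) (hrow : ∀ i, ∑ k, D.Sigma T k i ^ 2 ≤ ε ^ 2 * D.N T)
    (hg : 0 < g) (hγg : ∀ i, ∑ k, D.gamma T i k ^ 2 ≤ g) (hs : 0 < s)
    (hγs : ∀ a : Fin r → ℝ, D.N T * s * ∑ k, a k ^ 2 ≤ ∑ i, (∑ k, D.gamma T i k * a k) ^ 2)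
    (hμ : ∑ i, D.mu T i ^ 2 ≤ C ^ 2 * D.N T / T) (hrε : r * ε ≤ 1 / 4)
    (hsmall : (C ^ 2 + 8) * r * ε ^ 2 ≤ s / 24) :
    RegularSample (proj (D.designMatrix T ω)) (residualOne (D.designMatrix T ω)) (D.mu T)
      (D.gamma T) (D.latent T ω) (D.unitNoise T ω) (D.Sigma T) T τ ε g s C := by
  set X := D.designMatrix T ω
  have hT' : (0 : ℝ) < T := by exact_mod_cast hT
  have hle : ∀ x, ‖proj X x‖ ^ 2 ≤ ‖x‖ ^ 2 := by
    intro x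
    have h1 : ‖proj X x‖ ^ 2 = ⟪x, proj X x⟫ := by
      rw [← real_inner_self_eq_norm_sq, proj_symm, proj_proj]
    have h2 := real_inner_le_norm x (proj X x)
    by_contra! hlt
    have := abs_lt_of_sq_lt_sq hlt (norm_nonneg _)
    rw [abs_of_nonneg (norm_nonneg x)] at this
    nlinarith [norm_nonneg x]
  have hnorm : ∀ x : Fin T → ℝ, ‖WithLp.toLp 2 x‖ ^ 2 = ∑ t, x t ^ 2 := by
    intro x; rw [EuclideanSpace.norm_sq_eq]; simp
  have hin : ∀ x y : Fin T → ℝ, ⟪WithLp.toLp 2 x, WithLp.toLp 2 y⟫ = ∑ t, x t * y t :=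
    fun x y => inner_toLp x y
  have hb : residualOne X = WithLp.toLp 2 (annihilator X *ᵥ 1) := rfl
  have hsq : ∀ (a y : Fin T → ℝ), |∑ t, a t * y t| ≤ τ * √(∑ t, a t ^ 2) →
      ⟪WithLp.toLp 2 a, WithLp.toLp 2 y⟫ ^ 2 ≤ τ ^ 2 * ‖WithLp.toLp 2 a‖ ^ 2 := by
    intro a y hay
    rw [hin, hnorm, ← sq_abs]
    calc _ ≤ (τ * √(∑ t, a t ^ 2)) ^ 2 := by gcongr
      _ = _ := by rw [mul_pow, Real.sq_sqrt (Finset.sum_nonneg fun _ _ => sq_nonneg _)]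
  have hbT : ‖residualOne X‖ ^ 2 ≤ T := by
    refine (hle _).trans_eq ?_
    rw [hnorm]; simp
  have hsub : ∀ y : Fin T → ℝ, (∀ s, |∑ t, (1 - annihilator X) s t * y t|
      ≤ τ * √(∑ t, (1 - annihilator X) s t ^ 2)) →
      ‖WithLp.toLp 2 y - proj X (WithLp.toLp 2 y)‖ ^ 2 ≤ ε * T := by
    intro y hy
    have e1 : WithLp.toLp 2 y - proj X (WithLp.toLp 2 y)
        = WithLp.toLp 2 ((1 - annihilator X) *ᵥ y) := by
      rw [proj_toLp, Matrix.sub_mulVec, Matrix.one_mulVec]; rfl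
    -- The squared Frobenius norm of an orthogonal projection is its trace, here the number of
    -- regressors. Bounding each coordinate by `τ` times its row norm thus costs only `p τ²` in
    -- total.
    have e2 : ∑ s, ∑ t, (1 - annihilator X) s t ^ 2 = p := by
      rw [← trace_one_sub_annihilator hu]
      have e3 : (1 - annihilator X) * (1 - annihilator X)ᵀ = 1 - annihilator X := by
        rw [Matrix.transpose_sub, Matrix.transpose_one, annihilator_transpose]
        simp only [Matrix.mul_sub, Matrix.sub_mul, Matrix.mul_one, Matrix.one_mul,
          annihilator_mul_self]
        simp
      conv_rhs => rw [← e3]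
      simp only [Matrix.trace, Matrix.diag_apply, Matrix.mul_apply, Matrix.transpose_apply, sq]
    rw [e1, hnorm]
    calc _ ≤ ∑ s, τ ^ 2 * ∑ t, (1 - annihilator X) s t ^ 2 := by
          refine Finset.sum_le_sum fun s _ => ?_
          have := hsq _ _ (hy s)
          rw [hin, hnorm] at this
          exact this
      _ = p * τ ^ 2 := by rw [← Finset.mul_sum, e2]; ring
      _ ≤ _ := hpτ
  refine ⟨by exact_mod_cast hT, hτ1, hτ, hε, hε1, proj_symm X, proj_proj X, proj_proj X _, hbT,
    fun k l => ?_, fun k => ?_, fun k i => ?_, fun i => ?_, fun i => ?_, fun k => ?_, fun k i => ?_,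
    hd, hrow, hg, hγg, hs, hγs, hμ, hrε, hsmall⟩
  · have := h.latent_latent (k, l)
    rw [latent, latent, hin]
    simpa [Matrix.one_apply] using this
  · exact hsub _ fun s => h.design_latent (s, k)
  · rw [unitNoise, unitNoise, hin]
    exact h.noise_noise (k, i)
  · exact hsub _ fun s => h.design_noise (s, i)
  · rw [hb]
    refine (hsq _ _ (h.one_noise i)).trans ?_
    gcongr
    exact hbT
  · rw [hb]
    refine (hsq _ _ (h.one_latent k)).trans ?_
    gcongr
    exact hbT
  · rw [latent, proj_toLp]
    refine (hsq _ _ (h.latent_noise (k, i))).trans ?_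
    have h1 : ‖WithLp.toLp 2 (annihilator X *ᵥ fun t => D.Z T t ω k)‖ ^ 2 ≤ 2 * T := by
      rw [← proj_toLp]
      refine (hle _).trans ?_
      have := (abs_le.1 (h.latent_latent (k, k))).2
      simp only [Matrix.one_apply_eq, mul_one, ← sq] at this
      rw [hnorm]
      nlinarith
    calc _ ≤ τ ^ 2 * (2 * T) := by gcongr
      _ = _ := by ring

end Panel

/-! ### The normal distribution function and the threshold. -/

section Normal

lemma Phi_strictMono : StrictMono Phi := by
  intro a b hab
  rw [Phi, Phi, cdf_eq_real, cdf_eq_real, ← Set.Iic_union_Ioc_eq_Iic hab.le,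
    measureReal_union (Set.Iic_disjoint_Ioc le_rfl) measurableSet_Ioc, lt_add_iff_pos_right,
    measureReal_def, ENNReal.toReal_pos_iff]
  refine ⟨pos_iff_ne_zero.2 fun h0 => ?_, measure_lt_top _ _⟩
  have := gaussianReal_absolutelyContinuous' 0 (one_ne_zero (α := NNReal)) h0
  rw [Real.volume_Ioc, ENNReal.ofReal_eq_zero] at this
  linarith

lemma Phi_neg (x : ℝ) : Phi (-x) = 1 - Phi x := by
  have : NullSingletonClass (gaussianReal 0 1) := nullSingletonClass_gaussianReal one_ne_zero
  rw [Phi, Phi, cdf_eq_real, cdf_eq_real, ← probReal_compl_eq_one_sub measurableSet_Iic,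
    Set.compl_Iic]
  have h1 : gaussianReal 0 1 = (gaussianReal 0 1).map (fun x => -x) := by
    rw [gaussianReal_map_neg, neg_zero]
  conv_lhs => rw [h1]
  rw [map_measureReal_apply measurable_neg measurableSet_Iic]
  have h2 : (fun x : ℝ => -x) ⁻¹' Set.Iic (-x) = Set.Ici x := by ext y; simp
  rw [h2, measureReal_def, measureReal_def, measure_congr Ioi_ae_eq_Ici]

lemma pValue_le_iff {n T p r : ℕ} (X : Matrix (Fin T) (Fin p) ℝ) (Y : Matrix (Fin n) (Fin T) ℝ)
    (v : Fin r → EuclideanSpace ℝ (Fin T)) (i : Fin n) (x : ℝ) :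
    pValue X Y v i ≤ 2 * (1 - Phi x) ↔ x ≤ |testStat X Y v i| := by
  rw [pValue, ← Phi_neg, mul_le_mul_iff_right₀ two_pos, Phi_strictMono.le_iff_le, neg_le_neg_iff]

lemma tendsto_threshold {u : ℕ → ℝ} (hu : Tendsto u atTop atTop) :
    Tendsto (fun T => 2 * (1 - Phi (u T))) atTop (𝓝 0) := by
  have h : Tendsto Phi atTop (𝓝 1) := tendsto_cdf_atTop _
  simpa using ((h.comp hu).const_sub 1).const_mul 2

end Normal

/-! ### Growth rates, and uniform positivity of a positive definite form. -/

section Asymptotics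

lemma eventually_mul_rpow_le {a b : ℝ} (hab : a < b) (K : ℝ) {δ : ℝ} (hδ : 0 < δ) :
    ∀ᶠ T : ℕ in atTop, K * (T : ℝ) ^ a ≤ δ * (T : ℝ) ^ b := by
  have h1 : Tendsto (fun T : ℕ => (T : ℝ) ^ (b - a)) atTop atTop :=
    (tendsto_rpow_atTop (sub_pos.2 hab)).comp tendsto_natCast_atTop_atTop
  filter_upwards [h1.eventually_ge_atTop (K / δ), eventually_gt_atTop 0] with T hT hT0
  have hT' : (0 : ℝ) < T := by exact_mod_cast hT0
  rw [div_le_iff₀ hδ] at hT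
  have h2 : (T : ℝ) ^ b = (T : ℝ) ^ (b - a) * (T : ℝ) ^ a := by
    rw [← Real.rpow_add hT']; congr 1; ring
  rw [h2]
  have := Real.rpow_pos_of_pos hT' a
  nlinarith

lemma tendsto_mul_exp_mul_exp_neg {h θ a : ℝ} (hθ : 0 < θ) (hhθ : h < θ) (ha : 0 < a) (B : ℝ) :
    Tendsto (fun T : ℕ => (T : ℝ) * (Real.exp (B * (T : ℝ) ^ h) * Real.exp (-(a * (T : ℝ) ^ θ))))
      atTop (𝓝 0) := by
  have h1 : Tendsto (fun T : ℕ => (T : ℝ) ^ θ) atTop atTop :=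
    (tendsto_rpow_atTop hθ).comp tendsto_natCast_atTop_atTop
  have h2 := (tendsto_rpow_mul_exp_neg_mul_atTop_nhds_zero θ⁻¹ (a / 2) (by positivity)).comp h1
  refine squeeze_zero' (Eventually.of_forall fun T => by positivity) ?_ h2
  -- Half of the decay rate absorbs `exp (B T^h)`; the other half beats the factor `T`.
  filter_upwards [eventually_mul_rpow_le hhθ B (half_pos ha)] with T hT
  simp only [Function.comp_apply]
  rw [← Real.rpow_mul (Nat.cast_nonneg T), mul_inv_cancel₀ hθ.ne', Real.rpow_one, ← Real.exp_add]
  gcongr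
  linarith

lemma exists_pos_mul_sum_sq_le {r : ℕ} {S : Matrix (Fin r) (Fin r) ℝ} (hS : S.PosDef) :
    ∃ m : ℝ, 0 < m ∧ ∀ a : Fin r → ℝ, m * ∑ k, a k ^ 2 ≤ a ⬝ᵥ (S *ᵥ a) := by
  have hpos : ∀ a : Fin r → ℝ, a ≠ 0 → 0 < a ⬝ᵥ (S *ᵥ a) := fun a ha => by
    simpa using hS.dotProduct_mulVec_pos ha
  have hcont : Continuous fun a : EuclideanSpace ℝ (Fin r) => a.ofLp ⬝ᵥ (S *ᵥ a.ofLp) := by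
    simp only [dotProduct, Matrix.mulVec]
    fun_prop
  have key : ∀ m : ℝ, (∀ u ∈ Metric.sphere (0 : EuclideanSpace ℝ (Fin r)) 1,
      m ≤ u.ofLp ⬝ᵥ (S *ᵥ u.ofLp)) → ∀ a : Fin r → ℝ, m * ∑ k, a k ^ 2 ≤ a ⬝ᵥ (S *ᵥ a) := by
    intro m hm a
    rcases eq_or_ne a 0 with rfl | ha
    · simp
    set y : EuclideanSpace ℝ (Fin r) := WithLp.toLp 2 a with hy
    have hy0 : y ≠ 0 := fun h0 => ha (by simpa [hy] using h0)
    have hn : 0 < ‖y‖ := norm_pos_iff.2 hy0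
    have hsq : ‖y‖ ^ 2 = ∑ k, a k ^ 2 := by rw [EuclideanSpace.norm_sq_eq]; simp [hy]
    have h1 := hm (‖y‖⁻¹ • y) (by simp [norm_smul, hn.ne'])
    have h2 : (‖y‖⁻¹ • y).ofLp ⬝ᵥ (S *ᵥ (‖y‖⁻¹ • y).ofLp) = (‖y‖ ^ 2)⁻¹ * (a ⬝ᵥ (S *ᵥ a)) := by
      rw [WithLp.ofLp_smul, Matrix.mulVec_smul, smul_dotProduct, dotProduct_smul, smul_eq_mul,
        smul_eq_mul, ← mul_assoc, ← sq, inv_pow]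
    rw [h2, inv_mul_eq_div, le_div_iff₀ (by positivity), hsq] at h1
    exact h1
  -- For `r = 0` the unit sphere is empty and any constant serves; otherwise the minimum on the
  -- compact sphere does.
  rcases (Metric.sphere (0 : EuclideanSpace ℝ (Fin r)) 1).eq_empty_or_nonempty with he | hne
  · exact ⟨1, one_pos, key 1 (by simp [he])⟩
  · obtain ⟨u, hu, hmin⟩ := (isCompact_sphere (0 : EuclideanSpace ℝ (Fin r)) 1).exists_isMinOn hne
      hcont.continuousOn
    refine ⟨_, hpos u.ofLp fun h0 => ?_, key _ fun w hw => hmin hw⟩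
    have : u = 0 := by ext k; simp [h0]
    simp [this] at hu

end Asymptotics

/-! ### Eventual consequences of the assumptions. -/

namespace Panel

variable {p r : ℕ} {Ω : ℕ → Type*} [∀ T, MeasurableSpace (Ω T)] {D : Panel p r Ω}

lemma C4.eventually_le (hC4 : D.C4) (hN : Tendsto D.N atTop atTop) :
    ∃ s : ℝ, 0 < s ∧ ∀ᶠ T in atTop, ∀ a : Fin r → ℝ,
      D.N T * s * ∑ k, a k ^ 2 ≤ ∑ i, (∑ k, D.gamma T i k * a k) ^ 2 := by
  obtain ⟨⟨S, hS, hlim⟩, -⟩ := hC4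
  obtain ⟨m, hm, hmS⟩ := exists_pos_mul_sum_sq_le hS
  refine ⟨m / 2, half_pos hm, ?_⟩
  -- An entrywise error of this size changes the form by at most `r / (r + 1) · m / 2` times the
  -- squared norm; `r + 1` also avoids dividing by zero when `r = 0`.
  have hδ : 0 < m / 2 / (r + 1) := by positivity
  have hent : ∀ᶠ T in atTop, ∀ j k,
      |((D.N T : ℝ)⁻¹ • ((D.gamma T)ᵀ * D.gamma T)) j k - S j k| < m / 2 / (r + 1) := by
    refine eventually_all.2 fun j => eventually_all.2 fun k => ?_
    have h1 := ((continuous_apply_apply j k).tendsto S).comp hlim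
    exact Metric.tendsto_nhds.1 h1 _ hδ
  filter_upwards [hent, hN.eventually_gt_atTop 0] with T hT hN0 a
  set M := (D.N T : ℝ)⁻¹ • ((D.gamma T)ᵀ * D.gamma T) with hM
  have hN' : (0 : ℝ) < D.N T := by exact_mod_cast hN0
  have hA : 0 ≤ ∑ k, a k ^ 2 := Finset.sum_nonneg fun _ _ => sq_nonneg _
  have e1 : ∑ i, (∑ k, D.gamma T i k * a k) ^ 2 = D.N T * (a ⬝ᵥ (M *ᵥ a)) := by
    rw [hM, Matrix.smul_mulVec, dotProduct_smul, smul_eq_mul, ← mul_assoc,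
      mul_inv_cancel₀ hN'.ne', one_mul, ← Matrix.mulVec_mulVec, Matrix.dotProduct_mulVec,
      Matrix.vecMul_transpose]
    simp [dotProduct, Matrix.mulVec, sq]
  have e2 : |a ⬝ᵥ (M *ᵥ a) - a ⬝ᵥ (S *ᵥ a)| ≤ m / 2 * ∑ k, a k ^ 2 := by
    rw [← dotProduct_sub, ← Matrix.sub_mulVec]
    simp only [dotProduct, Matrix.mulVec, Finset.mul_sum, Matrix.sub_apply]
    calc _ ≤ ∑ j, ∑ k, |a j| * |a k| * (m / 2 / (r + 1)) := by
          refine (Finset.abs_sum_le_sum_abs _ _).trans (Finset.sum_le_sum fun j _ => ?_)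
          refine (Finset.abs_sum_le_sum_abs _ _).trans (Finset.sum_le_sum fun k _ => ?_)
          rw [abs_mul, abs_mul]
          have := (hT j k).le
          calc _ = |a j| * |a k| * |M j k - S j k| := by ring
            _ ≤ _ := by gcongr
      _ = (∑ k, |a k|) ^ 2 * (m / 2 / (r + 1)) := by
          rw [sq, Finset.sum_mul_sum]; simp_rw [Finset.sum_mul]
      _ ≤ (r * ∑ k, a k ^ 2) * (m / 2 / (r + 1)) := by gcongr; exact sq_sum_abs_le a
      _ = m / 2 * (∑ k, a k ^ 2) * (r / (r + 1)) := by field_simp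
      _ ≤ m / 2 * (∑ k, a k ^ 2) * 1 := by
          gcongr
          rw [div_le_one (by positivity)]
          linarith
      _ = ∑ k, m / 2 * a k ^ 2 := by rw [mul_one, Finset.mul_sum]
  have e3 := hmS a
  have e4 := (abs_le.1 e2).1
  rw [e1, mul_assoc]
  gcongr
  linarith

lemma exists_gamma_transpose_mulVec_eq {T : ℕ} {s : ℝ} (hN : 0 < D.N T) (hs : 0 < s)
    (hγ : ∀ a : Fin r → ℝ, D.N T * s * ∑ k, a k ^ 2 ≤ ∑ i, (∑ k, D.gamma T i k * a k) ^ 2)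
    (a : Fin r → ℝ) : ∃ u : Fin (D.N T) → ℝ, (D.gamma T)ᵀ *ᵥ u = a := by
  have hN' : (0 : ℝ) < D.N T := by exact_mod_cast hN
  have hinj : Function.Injective ((D.gamma T)ᵀ * D.gamma T).mulVec := by
    rw [Matrix.mulVec_injective_iff_isUnit, ← Matrix.mulVec_injective_iff_isUnit]
    intro x y hxy
    have h0 : ((D.gamma T)ᵀ * D.gamma T) *ᵥ (x - y) = 0 := by
      rw [Matrix.mulVec_sub]; exact sub_eq_zero.2 hxy
    have h1 : ∑ i, (∑ k, D.gamma T i k * (x - y) k) ^ 2 = 0 := by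
      have : (x - y) ⬝ᵥ (((D.gamma T)ᵀ * D.gamma T) *ᵥ (x - y)) = 0 := by rw [h0]; simp
      rw [← Matrix.mulVec_mulVec, Matrix.dotProduct_mulVec, Matrix.vecMul_transpose] at this
      rw [← this]
      simp [dotProduct, Matrix.mulVec, sq]
    have h2 := hγ (x - y)
    rw [h1] at h2
    have h3 : ∑ k, (x - y) k ^ 2 ≤ 0 := by
      by_contra! hlt
      have : 0 < D.N T * s * ∑ k, (x - y) k ^ 2 := by positivity
      linarith
    have h4 := (Finset.sum_eq_zero_iff_of_nonneg fun k (_ : k ∈ Finset.univ) =>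
      sq_nonneg ((x - y) k)).1 (le_antisymm h3 (Finset.sum_nonneg fun _ _ => sq_nonneg _))
    ext k
    have := h4 k (Finset.mem_univ k)
    simpa [sub_eq_zero] using this
  have hunit := Matrix.mulVec_injective_iff_isUnit.1 hinj
  obtain ⟨w, hw⟩ := (Matrix.mulVec_surjective_iff_isUnit.2 hunit) a
  exact ⟨D.gamma T *ᵥ w, by rw [Matrix.mulVec_mulVec]; exact hw⟩

/-- As variances are at most one, covariances are dominated by correlations, and the sum of all
their absolute values is `O(N + N^(2-δ)) = o(N²)`. Taking the root through `sq_sum_sq_row_le` gives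
`o(N)` for every row at once. -/
lemma WeakDependence.eventually_row_le (hweak : D.WeakDependence) (hN : Tendsto D.N atTop atTop)
    (hmodel : D.IsGaussianFactorModel) (hC3 : D.C3) {ε : ℝ} (hε : 0 < ε) :
    ∀ᶠ T in atTop, ∀ i, ∑ k, D.Sigma T k i ^ 2 ≤ ε ^ 2 * D.N T := by
  obtain ⟨δ, hδ, hO⟩ := hweak
  obtain ⟨σ₀, hσ₀, hσ⟩ := hC3
  obtain ⟨B, hB⟩ := hO.bound
  have hNr : Tendsto (fun T => (D.N T : ℝ)) atTop atTop := tendsto_natCast_atTop_atTop.comp hN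
  have hlim : Tendsto (fun T => (D.N T : ℝ)⁻¹ + B * (D.N T : ℝ) ^ (-δ)) atTop (𝓝 0) := by
    have h1 := tendsto_inv_atTop_zero.comp hNr
    have h2 := ((tendsto_rpow_neg_atTop hδ).comp hNr).const_mul B
    simpa using h1.add h2
  filter_upwards [hB, hσ, hN.eventually_gt_atTop 0, eventually_gt_atTop 0,
    hlim.eventually (gt_mem_nhds (show 0 < ε ^ 4 by positivity))] with T hBT hσT hN0 hT0 hlT i
  have hS := hmodel.isGaussianSample_noise hT0
  have hN' : (0 : ℝ) < D.N T := by exact_mod_cast hN0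
  have h1 := sq_sum_sq_row_le hS.symm hS.psd hS.diag_le i
  have hcorr : ∀ k l, |D.Sigma T k l| ≤ |D.corr T k l| := by
    intro k l
    have hpos : ∀ k, 0 < D.Sigma T k k := fun k => (by positivity : 0 < σ₀ ^ 2).trans_le (hσT k)
    have hle : √(D.Sigma T k k * D.Sigma T l l) ≤ 1 := by
      rw [Real.sqrt_le_one]
      exact mul_le_one₀ (hS.diag_le k) (hpos l).le (hS.diag_le l)
    have hp : 0 < √(D.Sigma T k k * D.Sigma T l l) := Real.sqrt_pos.2 (mul_pos (hpos k) (hpos l))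
    rw [corr, abs_div, abs_of_pos hp, le_div_iff₀ hp]
    exact mul_le_of_le_one_right (abs_nonneg _) hle
  have h2 : ∑ k, ∑ l, |D.Sigma T k l|
      ≤ D.N T + ∑ k, ∑ l, if k ≠ l then |D.corr T k l| else 0 := by
    calc _ ≤ ∑ k, ∑ l, ((if k = l then 1 else 0) + if k ≠ l then |D.corr T k l| else 0) := by
          refine Finset.sum_le_sum fun k _ => Finset.sum_le_sum fun l _ => ?_
          by_cases hkl : k = l
          · subst hkl
            simp only [if_true, ne_eq, not_true_eq_false, if_false, add_zero]
            rw [abs_of_nonneg ((sq_nonneg σ₀).trans (hσT k))]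
            exact hS.diag_le k
          · simpa [hkl] using hcorr k l
      _ = _ := by simp [Finset.sum_add_distrib]
  set G := ∑ k, ∑ l, if k ≠ l then |D.corr T k l| else 0
  have h3 : (D.N T : ℝ) ^ (-2 + δ) * G ≤ B := by
    have := (le_abs_self _).trans hBT
    simpa using this
  have h4 : G ≤ B * (D.N T : ℝ) ^ (2 - δ) := by
    have hp : 0 < (D.N T : ℝ) ^ (2 - δ) := Real.rpow_pos_of_pos hN' _
    calc G = (D.N T : ℝ) ^ (2 - δ) * ((D.N T : ℝ) ^ (-2 + δ) * G) := by
          rw [← mul_assoc, ← Real.rpow_add hN', show 2 - δ + (-2 + δ) = 0 by ring, Real.rpow_zero,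
            one_mul]
      _ ≤ (D.N T : ℝ) ^ (2 - δ) * B := by gcongr
      _ = _ := mul_comm _ _
  have h5 : (D.N T : ℝ) ^ (2 - δ) = (D.N T : ℝ) ^ 2 * (D.N T : ℝ) ^ (-δ) := by
    rw [sub_eq_add_neg, Real.rpow_add hN', Real.rpow_two]
  have h6 : (∑ k, D.Sigma T k i ^ 2) ^ 2 ≤ (ε ^ 2 * D.N T) ^ 2 := by
    calc _ ≤ D.N T + B * (D.N T : ℝ) ^ (2 - δ) := h1.trans (h2.trans (by gcongr))
      _ = (D.N T : ℝ) ^ 2 * ((D.N T : ℝ)⁻¹ + B * (D.N T : ℝ) ^ (-δ)) := by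
          rw [h5]; field_simp
      _ ≤ (D.N T : ℝ) ^ 2 * ε ^ 4 := by gcongr
      _ = _ := by ring
  exact abs_le_of_sq_le_sq' h6 (by positivity) |>.2

lemma C2.eventually_sum_sq_le (hC2 : D.C2) :
    ∃ C : ℝ, ∀ᶠ T : ℕ in atTop, ∑ i, D.mu T i ^ 2 ≤ C ^ 2 * D.N T / T := by
  obtain ⟨C, hC, h⟩ := hC2
  refine ⟨C, ?_⟩
  filter_upwards [h] with T hT
  have h1 : √(∑ i, D.mu T i ^ 2) ≤ C * (√(D.N T : ℝ) / √(T : ℝ)) :=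
    hT.trans (by gcongr; exact min_le_left _ _)
  rw [Real.sqrt_le_left (by positivity)] at h1
  refine h1.trans_eq ?_
  rw [mul_pow, div_pow, Real.sq_sqrt (Nat.cast_nonneg _), Real.sq_sqrt (Nat.cast_nonneg _)]
  ring

/-- With `N ≤ exp (C T^h)`, the quadratic statistics are controlled because `h < 1`, and the linear
ones because `h < 2 j`. -/
lemma C1.tendsto_bound {h : ℝ} (hC1 : D.C1 h) {j ε : ℝ} (hj : h / 2 < j) (hε : 0 < ε) :
    Tendsto (fun T : ℕ => ENNReal.ofReal
      (((D.N T : ℝ) ^ 2 + r ^ 2) * (4 * Real.exp (-(ε ^ 2 * T / 256)))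
        + (D.N T + r) * (1 + T + r) * (2 * Real.exp (-(((T : ℝ) ^ j) ^ 2 / 2))))) atTop (𝓝 0) := by
  obtain ⟨h0, h1, C, hC, hlog⟩ := hC1
  have l1 := (tendsto_mul_exp_mul_exp_neg (h := h) (θ := 1) (a := ε ^ 2 / 256) one_pos (by linarith)
    (by positivity) (2 * C)).const_mul (4 * (1 + r ^ 2 : ℝ))
  have l2 := (tendsto_mul_exp_mul_exp_neg (h := h) (θ := 2 * j) (a := 1 / 2) (by linarith)
    (by linarith) (by norm_num) C).const_mul (2 * ((1 + r) * (2 + r) : ℝ))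
  have l3 := l1.add l2
  rw [mul_zero, mul_zero, add_zero] at l3
  rw [← ENNReal.ofReal_zero]
  refine ENNReal.tendsto_ofReal (squeeze_zero' (Eventually.of_forall fun T => by positivity) ?_ l3)
  filter_upwards [hlog, eventually_gt_atTop 0] with T hT hT0
  have hT1 : (1 : ℝ) ≤ T := by exact_mod_cast hT0
  have hT' : (0 : ℝ) ≤ T := by linarith
  set E := Real.exp (C * (T : ℝ) ^ h) with hE
  have hE1 : 1 ≤ E := Real.one_le_exp (mul_nonneg hC.le (Real.rpow_nonneg hT' _))
  have hNE : (D.N T : ℝ) ≤ E := by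
    rcases Nat.eq_zero_or_pos (D.N T) with h | h
    · rw [h, Nat.cast_zero]; linarith
    · rw [← Real.log_le_iff_le_exp (by exact_mod_cast h)]; exact hT
  have hE2 : Real.exp (2 * C * (T : ℝ) ^ h) = E ^ 2 := by
    rw [hE, sq, ← Real.exp_add]; congr 1; ring
  have e1 : Real.exp (-(ε ^ 2 / 256 * (T : ℝ) ^ (1 : ℝ))) = Real.exp (-(ε ^ 2 * T / 256)) := by
    rw [Real.rpow_one]; congr 1; ring
  have e2 : Real.exp (-(1 / 2 * (T : ℝ) ^ (2 * j))) = Real.exp (-(((T : ℝ) ^ j) ^ 2 / 2)) := by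
    rw [mul_comm 2 j, Real.rpow_mul hT', Real.rpow_two]; congr 1; ring
  rw [e1, e2, hE2]
  set x := Real.exp (-(ε ^ 2 * T / 256))
  set y := Real.exp (-(((T : ℝ) ^ j) ^ 2 / 2))
  have hr : (0 : ℝ) ≤ r := Nat.cast_nonneg r
  have b1 : (D.N T : ℝ) ^ 2 + r ^ 2 ≤ (1 + r ^ 2) * (T * E ^ 2) := by
    have c1 : (D.N T : ℝ) ^ 2 ≤ E ^ 2 := by gcongr
    have c2 : (1 : ℝ) ≤ E ^ 2 := one_le_pow₀ hE1
    calc (D.N T : ℝ) ^ 2 + r ^ 2 ≤ E ^ 2 + r ^ 2 * E ^ 2 := by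
          gcongr; exact le_mul_of_one_le_right (by positivity) c2
      _ = (1 + r ^ 2) * (1 * E ^ 2) := by ring
      _ ≤ _ := by gcongr
  have b2 : ((D.N T : ℝ) + r) * (1 + T + r) ≤ (1 + r) * (2 + r) * (T * E) := by
    calc _ ≤ (E + r * E) * (T + T + r * T) := by
          gcongr
          · exact le_mul_of_one_le_right hr hE1
          · exact le_mul_of_one_le_right hr hT1
      _ = _ := by ring
  calc _ ≤ (1 + r ^ 2) * (T * E ^ 2) * (4 * x) + (1 + r) * (2 + r) * (T * E) * (2 * y) := by
        gcongr
    _ = _ := by ring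

end Panel

/-! ### Separation of null and non-null statistics, and exact selection. -/

section Selection

/-- If the numerator of the ratio `√T / √q * (num / den)` has no signal and the denominator is
bounded from below, then the ratio is small. -/
lemma abs_ratio_lt {T q num den c K κ τ x : ℝ} (hT : 0 < T) (hc : 0 < c) (hκ : 0 < κ)
    (hq : c * T ≤ q) (hnum : |num| ≤ K * τ * √T) (hden : κ * √T ≤ den)
    (hx : K / (√c * κ) * τ < x) : |√T / √q * (num / den)| < x := by
  have hA : 0 < √T := Real.sqrt_pos.2 hT
  have hcs : 0 < √c := Real.sqrt_pos.2 hc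
  have hqs : √c * √T ≤ √q := by
    rw [← Real.sqrt_mul hc.le]; exact Real.sqrt_le_sqrt hq
  have hq0 : 0 < √q := (by positivity : 0 < √c * √T).trans_le hqs
  have hd0 : 0 < den := (by positivity : 0 < κ * √T).trans_le hden
  rw [abs_mul, abs_div, abs_div, abs_of_pos hA, abs_of_pos hq0, abs_of_pos hd0]
  refine lt_of_le_of_lt ?_ hx
  calc √T / √q * (|num| / den) ≤ √T / (√c * √T) * (K * τ * √T / (κ * √T)) := by
        gcongr
        exact (abs_nonneg _).trans hnum
    _ = _ := by field_simp

/-- If the numerator of the ratio `√T / √q * (num / den)` contains a signal, then the ratio is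
large. -/
lemma le_abs_ratio {T q d num den c K K' τ x μ m : ℝ} (hT : 0 < T) (hc : 0 < c)
    (hq : c * T ≤ q) (hqT : q ≤ T) (hd : d ≤ c / 2 * T)
    (hnum : |num - μ * (q - d)| ≤ K * τ * √T) (hden : den ≤ (|μ| + K') * √T) (hden0 : 0 ≤ den)
    (hnz : den = 0 → num = 0)
    (hx : 0 < x) (hx1 : x ≤ c / 4 * √T) (hm : m ≤ |μ|) (hK' : 0 ≤ K')
    (hx2 : x * K' + K * τ < c / 4 * m * √T) :
    x ≤ |√T / √q * (num / den)| := by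
  have hA : 0 < √T := Real.sqrt_pos.2 hT
  have hAA : √T * √T = T := Real.mul_self_sqrt hT.le
  have hq0 : 0 < q := (by positivity : 0 < c * T).trans_le hq
  have hqs : 0 < √q := Real.sqrt_pos.2 hq0
  have h1 : |μ| * (c / 2 * T) ≤ |μ * (q - d)| := by
    rw [abs_mul]
    gcongr
    exact (by linarith : c / 2 * T ≤ q - d).trans (le_abs_self _)
  have h2 : |μ| * (c / 2 * T) - K * τ * √T ≤ |num| := by
    have := abs_sub_abs_le_abs_sub (μ * (q - d)) num
    rw [abs_sub_comm] at this
    linarith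
  -- Half of the signal dominates `x |μ|`, using `x ≤ c √T / 4`, and the other half dominates `x K'
  -- + K τ`, using `m ≤ |μ|`. The first covers large intercepts, the second small ones.
  have h3 : x * (|μ| + K') + K * τ < c / 2 * |μ| * √T := by
    have := mul_le_mul_of_nonneg_right hx1 (abs_nonneg μ)
    have : c / 4 * m * √T ≤ c / 4 * |μ| * √T := by gcongr
    nlinarith
  have h4 : x * ((|μ| + K') * √T) < |num| := by
    have h := mul_lt_mul_of_pos_right h3 hA
    rw [mul_assoc (c / 2 * |μ|), hAA] at h
    linarith [show (x * (|μ| + K') + K * τ) * √T = x * ((|μ| + K') * √T) + K * τ * √T by ring]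
  have h5 : x * den ≤ |num| := (mul_le_mul_of_nonneg_left hden hx.le).trans h4.le
  have h6 : 1 ≤ √T / √q := by
    rw [one_le_div hqs]; exact Real.sqrt_le_sqrt hqT
  have h0 : 0 < den := by
    refine hden0.lt_of_ne fun h0 => ?_
    rw [hnz h0.symm, abs_zero] at h4
    exact absurd h4 (not_lt.2 (by positivity))
  rw [abs_mul, abs_div num, abs_of_pos h0, abs_of_pos (by positivity : 0 < √T / √q)]
  have : x ≤ |num| / den := by rwa [le_div_iff₀ h0]
  calc x ≤ 1 * (|num| / den) := by rwa [one_mul]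
    _ ≤ _ := by gcongr

end Selection

namespace Panel

variable {p r : ℕ} {Ω : ℕ → Type*} [∀ T, MeasurableSpace (Ω T)] {D : Panel p r Ω}

/-- On a typical sample, the units with p-value below the threshold are exactly the non-nulls. -/
lemma mem_exactSelection {T : ℕ} {ω : Ω T} {v : Ω T → Fin r → EuclideanSpace ℝ (Fin T)}
    {τ ε g s C σ₀ c x m : ℝ}
    (hreg : RegularSample (proj (D.designMatrix T ω)) (residualOne (D.designMatrix T ω)) (D.mu T)
      (D.gamma T) (D.latent T ω) (D.unitNoise T ω) (D.Sigma T) T τ ε g s C)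
    (hu : IsUnit ((D.designMatrix T ω)ᵀ * D.designMatrix T ω).det) (hN : 0 < D.N T)
    (hv : IsLeadingEigenvectors (pcaMatrix (D.designMatrix T ω) (D.responseMatrix T ω)) (v ω))
    (hσ₀ : 0 < σ₀) (hσ : ∀ i, σ₀ ^ 2 ≤ D.Sigma T i i)
    (hε : ε * (2 + √(2 * g * r)
      + √(4 * (g + 1) * (r * (3 * (C ^ 2 + 2 * g * r + 10) / (s / 48))))) ≤ σ₀ ^ 2 / 2)
    (hc : 0 < c) (hq : c * T ≤ oneQone (D.designMatrix T ω))
    (hm : ∀ i ∈ D.nonNull T, m ≤ |D.mu T i|) (hx : 0 < x)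
    (hnull : √(4 * (g * r + 1) + 8 * (g + 1) * (r * (3 * (C ^ 2 + g * r + 1) / (s / 48))))
      / (√c * √(σ₀ ^ 4 / 8)) * τ < x)
    (hd : r * (3 * (C ^ 2 + g * r + 1) / (s / 48)) * τ ^ 2 ≤ c / 2 * T)
    (hx1 : x ≤ c / 4 * √(T : ℝ))
    (hx2 : x * √(4 * (g + 1))
      + √(4 * (g * r + 1) + 8 * (g + 1) * (r * (3 * (C ^ 2 + g * r + 1) / (s / 48)))) * τ
        < c / 4 * m * √(T : ℝ)) :
    ω ∈ D.exactSelection T v (2 * (1 - Phi x)) := by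
  set X := D.designMatrix T ω
  set Y := D.responseMatrix T ω
  have hT : (0 : ℝ) < T := hreg.T_pos
  have hT' : 0 < T := by exact_mod_cast hT
  have hτ : 0 ≤ τ := zero_le_one.trans hreg.one_le_τ
  have hs := hreg.s_pos
  have hg := hreg.g_pos
  have hR : ∀ i, WithLp.toLp 2 (residual X Y i) = unitResidual (proj X) (residualOne X) (D.mu T)
      (D.gamma T) (D.latent T ω) (D.unitNoise T ω) i :=
    toLp_residual (β := D.beta T) hu fun i t => rfl
  have hpd := hreg.principalDirections hR hN hv
  set K := √(4 * (g * r + 1) + 8 * (g + 1) * (r * (3 * (C ^ 2 + g * r + 1) / (s / 48))))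
  have hnum : ∀ i, |⟪residualOne X, rejection (v ω) (unitResidual (proj X) (residualOne X) (D.mu T)
      (D.gamma T) (D.latent T ω) (D.unitNoise T ω) i)⟫ - D.mu T i *
        (oneQone X - ∑ j, ⟪v ω j, residualOne X⟫ ^ 2)| ≤ K * τ * √(T : ℝ) := by
    intro i
    apply abs_le_of_sq_le_sq _ (by positivity)
    rw [← norm_residualOne_sq]
    refine (hreg.inner_rejection_sub_sq_le hpd i).trans_eq ?_
    rw [mul_pow, mul_pow, Real.sq_sqrt hT.le, Real.sq_sqrt (by positivity)]
    ring
  rw [exactSelection, Set.mem_ofPred_eq]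
  ext i
  rw [selected, Set.mem_ofPred_eq, pValue_le_iff, testStat_eq hT' X Y hpd.orthonormal, hR]
  by_cases hi : i ∈ D.nonNull T
  · refine iff_of_true ?_ hi
    refine le_abs_ratio hT hc hq ?_ ((hreg.sum_inner_direction_b_sq_le hpd).trans hd) (hnum i)
      (hreg.norm_rejection_unitResidual_le hpd i) (norm_nonneg _) (fun h0 => ?_) hx hx1 (hm i hi)
      (Real.sqrt_nonneg _) hx2
    · rw [← norm_residualOne_sq]; exact hreg.norm_b
    · rw [norm_eq_zero.1 h0, inner_zero_right]
  · refine iff_of_false (not_le.2 ?_) hi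
    have hμ : D.mu T i = 0 := not_not.1 hi
    have h1 := hnum i
    rw [hμ, zero_mul, sub_zero] at h1
    refine abs_ratio_lt hT hc (by positivity) hq h1 ?_ hnull
    rw [← Real.sqrt_mul (by positivity)]
    exact (Real.sqrt_le_left (norm_nonneg _)).2 (hreg.le_norm_rejection_sq hpd hμ (hσ i) hε)

/-- Exact selection at the threshold `2 (1 - Φ(c₂ T ^ j))`. -/
lemma withProbTendingToOne_exactSelection (hN : Tendsto D.N atTop atTop)
    (hmodel : D.IsGaussianFactorModel) (hdesign : D.NondegenerateDesign)
    (hweak : D.WeakDependence)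
    {h : ℝ} (hC1 : D.C1 h) (hC2 : D.C2) (hC3 : D.C3) (hC4 : D.C4)
    {c₁ κ : ℝ} (hc₁ : 0 < c₁)
    (hsignal : ∀ᶠ T : ℕ in atTop, ∀ i ∈ D.nonNull T, c₁ * (T : ℝ) ^ (-κ) ≤ |D.mu T i|)
    {v : ∀ T, Ω T → Fin r → EuclideanSpace ℝ (Fin T)}
    (hv : ∀ T, r ≤ T → ∀ ω, IsLeadingEigenvectors
      (pcaMatrix (D.designMatrix T ω) (D.responseMatrix T ω)) (v T ω))
    {c₂ j : ℝ} (hc₂ : 0 < c₂) (hj : h / 2 < j) (hjκ : j < 1 / 2 - κ) (hj1 : j < 1 / 2) :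
    WithProbTendingToOne D.P fun T =>
      D.exactSelection T (v T) (2 * (1 - Phi (c₂ * (T : ℝ) ^ j))) := by
  obtain ⟨s, hs, hγs⟩ := hC4.eventually_le hN
  obtain ⟨-, g, hg, hγg⟩ := hC4
  obtain ⟨C, hμ⟩ := hC2.eventually_sum_sq_le
  obtain ⟨c, hc, hdes⟩ := hdesign
  have hrow := fun ε (hε : (0 : ℝ) < ε) => hweak.eventually_row_le hN hmodel hC3 hε
  obtain ⟨σ₀, hσ₀, hσ⟩ := hC3
  have hh := hC1.1
  -- The fluctuation level is `τ = T^j'`: high enough for the union bound over the units, yet of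
  -- smaller order than the threshold.
  obtain ⟨j', hj'h, hj'j⟩ := exists_between hj
  set Kd := 2 + √(2 * g * r) + √(4 * (g + 1) * (r * (3 * (C ^ 2 + 2 * g * r + 10) / (s / 48))))
  set Kb := r * (3 * (C ^ 2 + g * r + 1) / (s / 48))
  set Kn := √(4 * (g * r + 1) + 8 * (g + 1) * Kb)
  -- The accuracy `ε` of the second moments need not tend to zero; a constant depending only on the
  -- model constants suffices.
  obtain ⟨ε, ⟨⟨⟨hε1, hε2⟩, hε3⟩, hε4⟩, hε⟩ : ∃ ε : ℝ, (((ε ≤ 1 ∧ r * ε ≤ 1 / 4) ∧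
      (C ^ 2 + 8) * r * ε ^ 2 ≤ s / 24) ∧ ε * Kd ≤ σ₀ ^ 2 / 2) ∧ 0 < ε := by
    have hlim : ∀ (f : ℝ → ℝ) (y : ℝ), Continuous f → f 0 < y → ∀ᶠ e in 𝓝[>] (0 : ℝ), f e ≤ y :=
      fun f y hf h0 => ((hf.tendsto 0).mono_left nhdsWithin_le_nhds).eventually (ge_mem_nhds h0)
    exact ((((hlim id 1 continuous_id one_pos).and
      (hlim (fun e => r * e) (1 / 4) (by fun_prop) (by norm_num))).and
      (hlim (fun e => (C ^ 2 + 8) * r * e ^ 2) (s / 24) (by fun_prop) (by simpa using hs))).and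
      (hlim (fun e => e * Kd) (σ₀ ^ 2 / 2) (by fun_prop)
        (by rw [zero_mul]; positivity))).and self_mem_nhdsWithin |>.exists
  have hbound := hC1.tendsto_bound (r := r) hj'h hε
  have hsum := hdes.add hbound
  rw [add_zero] at hsum
  refine tendsto_of_tendsto_of_tendsto_of_le_of_le' tendsto_const_nhds hsum
    (Eventually.of_forall fun _ => zero_le) ?_
  filter_upwards [hγs, hγg, hμ, hrow ε hε, hσ, hsignal, hN.eventually_gt_atTop 0,
    eventually_gt_atTop 0, eventually_ge_atTop r,
    eventually_mul_rpow_le (show 2 * j' < 1 by linarith) 1 (show 0 < ε ^ 2 by positivity),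
    eventually_mul_rpow_le (show 2 * j' < 1 by linarith) p hε,
    eventually_mul_rpow_le (show 2 * j' < 1 by linarith) Kb (show 0 < c / 2 by positivity),
    -- The `+ 1` here and two lines below turns weak inequalities into strict ones. The two bounds
    -- with `c / 8` add up to the signal share `c / 4`.
    eventually_mul_rpow_le hj'j (Kn / (√c * √(σ₀ ^ 4 / 8)) + 1) hc₂,
    eventually_mul_rpow_le hj1 c₂ (show 0 < c / 4 by positivity),
    eventually_mul_rpow_le hjκ (c₂ * √(4 * (g + 1)) + 1) (show 0 < c / 8 * c₁ by positivity),
    eventually_mul_rpow_le (hj'j.trans hjκ) Kn (show 0 < c / 8 * c₁ by positivity)] with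
    T hγsT hγgT hμT hrowT hσT hsigT hN0 hT0 hrT hτ1 hτ2 hτ3 hx1 hx2 hx3 hx4
  have hT' : (0 : ℝ) < T := by exact_mod_cast hT0
  have hT1 : (1 : ℝ) ≤ T := by exact_mod_cast hT0
  have hη := hmodel.isGaussianSample_noise hT0
  have hZ := hmodel.isGaussianSample_Z (exists_gamma_transpose_mulVec_eq hN0 hs hγsT)
  have hj'0 : 0 < j' := by linarith
  set τ := (T : ℝ) ^ j'
  have hτ : 1 ≤ τ := Real.one_le_rpow hT1 hj'0.le
  have hτsq : (T : ℝ) ^ (2 * j') = τ ^ 2 := by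
    rw [mul_comm, Real.rpow_mul hT'.le, Real.rpow_two]
  rw [hτsq, Real.rpow_one] at hτ1 hτ2 hτ3
  rw [← Real.sqrt_eq_rpow] at hx2
  have hκT : (T : ℝ) ^ (1 / 2 - κ) = (T : ℝ) ^ (-κ) * √(T : ℝ) := by
    rw [Real.sqrt_eq_rpow, ← Real.rpow_add hT']; congr 1; ring
  rw [hκT] at hx3 hx4
  have hTj : 0 < (T : ℝ) ^ j := Real.rpow_pos_of_pos hT' j
  -- Failure of exact selection forces a degenerate design or an atypical sample. Only monotonicity
  -- of the outer measure is used, so `v` may depend on the sample in a non-measurable way.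
  refine (measure_mono ?_).trans ((measure_union_le _ _).trans (add_le_add le_rfl
    (hmodel.measure_not_isTypical_le hT0 hZ (zero_le_one.trans hτ) hε hε1)))
  intro ω hω
  by_contra hcon
  simp only [Set.mem_union, Set.mem_compl_iff, Set.mem_ofPred_eq, not_or, not_not] at hcon
  obtain ⟨⟨hu, hq⟩, htyp⟩ := hcon
  refine hω ?_
  have hreg := htyp.regularSample hu hT0 hτ (by linarith) hτ2 hε hε1 hη.diag_le hrowT hg hγgT hs
    hγsT hμT hε2 hε3
  refine mem_exactSelection hreg hu hN0 (hv T hrT ω) hσ₀ hσT hε4 hc hq hsigT (by positivity)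
    ?_ hτ3 hx2 ?_
  · refine lt_of_lt_of_le ?_ hx1
    rw [add_mul, one_mul]
    exact lt_add_of_pos_right _ (zero_lt_one.trans_le hτ)
  · have e1 : c₂ * (T : ℝ) ^ j * √(4 * (g + 1)) = c₂ * √(4 * (g + 1)) * (T : ℝ) ^ j := by ring
    have e2 : c / 4 * (c₁ * (T : ℝ) ^ (-κ)) * √(T : ℝ)
        = c / 8 * c₁ * ((T : ℝ) ^ (-κ) * √(T : ℝ)) + c / 8 * c₁ * ((T : ℝ) ^ (-κ) * √(T : ℝ)) := by
      ring
    rw [add_mul, one_mul] at hx3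
    rw [e1, e2]
    change _ + Kn * τ < _
    linarith

end Panel

end FAT
end

theorem theorem2 {p r : ℕ} {Ω : ℕ → Type*} [∀ T, MeasurableSpace (Ω T)]
    (D : FAT.Panel p r Ω) (hN : Tendsto D.N atTop atTop)
    (hmodel : D.IsGaussianFactorModel) (hdesign : D.NondegenerateDesign)
    (hweak : D.WeakDependence)
    (h : ℝ) (hC1 : D.C1 h) (hC2 : D.C2) (hC3 : D.C3) (hC4 : D.C4) (hC5 : D.C5)
    (hnull : D.AsymptoticallyAllNull)
    (c₁ κ : ℝ) (hc₁ : 0 < c₁) (hκ : κ + h / 2 < 1 / 2)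
    (hsignal : ∀ᶠ T : ℕ in atTop, ∀ i ∈ D.nonNull T, c₁ * (T : ℝ) ^ (-κ) ≤ |D.mu T i|)
    (v : ∀ T, Ω T → Fin r → EuclideanSpace ℝ (Fin T))
    (hv : ∀ T, r ≤ T → ∀ ω, FAT.IsLeadingEigenvectors
      (FAT.pcaMatrix (D.designMatrix T ω) (D.responseMatrix T ω)) (v T ω)) :
    (∃ s : ℕ → ℝ, Tendsto s atTop (𝓝 0) ∧
      FAT.WithProbTendingToOne D.P fun T => D.exactSelection T (v T) (s T)) ∧
    ∀ c₂ : ℝ, 0 < c₂ → ∀ j : ℝ, h / 2 < j → j < 1 / 2 - κ → j < 1 / 2 →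
      Tendsto (fun T : ℕ => 2 * (1 - FAT.Phi (c₂ * (T : ℝ) ^ j))) atTop (𝓝 0) ∧
      FAT.WithProbTendingToOne D.P fun T =>
        D.exactSelection T (v T) (2 * (1 - FAT.Phi (c₂ * (T : ℝ) ^ j))) := by
  have key : ∀ c₂ : ℝ, 0 < c₂ → ∀ j : ℝ, h / 2 < j → j < 1 / 2 - κ → j < 1 / 2 →
      Tendsto (fun T : ℕ => 2 * (1 - FAT.Phi (c₂ * (T : ℝ) ^ j))) atTop (𝓝 0) ∧
      FAT.WithProbTendingToOne D.P fun T =>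
        D.exactSelection T (v T) (2 * (1 - FAT.Phi (c₂ * (T : ℝ) ^ j))) := by
    intro c₂ hc₂ j hj hjκ hj1
    have hj0 : 0 < j := (half_pos hC1.1).trans hj
    exact ⟨FAT.tendsto_threshold (((tendsto_rpow_atTop hj0).comp
        tendsto_natCast_atTop_atTop).const_mul_atTop hc₂),
      FAT.Panel.withProbTendingToOne_exactSelection hN hmodel hdesign hweak hC1 hC2 hC3 hC4 hc₁
        hsignal hv hc₂ hj hjκ hj1⟩
  refine ⟨?_, key⟩
  obtain ⟨j, hj, hj'⟩ := exists_between
    (show h / 2 < min (1 / 2 - κ) (1 / 2) from lt_min (by linarith) (by linarith [hC1.2.1]))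
  obtain ⟨h1, h2⟩ := lt_min_iff.1 hj'
  exact ⟨_, key 2 two_pos j hj h1 h2⟩
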